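/- Let $-\infty\le a<b\le\infty$, let $J\in\mathbb C^{n\times n}$ be invertible and skew-Hermitian, and let $q,w$ be $n\times n$ matrices of distributions of order zero on $(a,b)$ (derivatives $q=Q'$, $w=W'$ of matrix functions of locally bounded variation, i.e. measures on compact subintervals), with $q$ Hermitian and $w$ non-negative. A function $u$ of locally bounded variation with one-sided limits $u^\pm$ is balanced if $u=(u^++u^-)/2$. Let $\mathcal L^2(w)$ be the space of measurable $f:(a,b)\to\mathbb C^n$ with $\|f\|^2=\int f^*wf<\infty$ and $[u]=\{v\in\mathcal L^2(w):\|v-u\|=0\}$. Put $$\mathcal T_{\max}=\{(u,f)\in\mathcal L^2(w)\times\mathcal L^2(w): u \text{ balanced, of locally bounded variation},\ Ju'+qu=wf\},$$ $$T_{\max}=\{([u],[f]):(u,f)\in\mathcal T_{\max}\},$$ and let $\mathcal L_0$ be the space of balanced $u$ of locally bounded variation on $(a,b)$ with $Ju'+qu=0$ and $\|u\|=0$. Let $B_\pm(x)=J\pm\frac12(Q^+(x)-Q^-(x))$, and let $(\tau_k)_{k\in\mathbb Z}$ be a strictly increasing sequence in $(a,b)$ with $\tau_k\to a$ as $k\to-\infty$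 and $\tau_k\to b$ as $k\to\infty$, containing every $x\in(a,b)$ for which $B_+(x)$ or $B_-(x)$ is not invertible, and such that $B_+(\tau_0)=B_-(\tau_0)=J$. Define $N_0=\{h(\tau_0):h\in\mathcal L_0\}$ and, for $k\ge1$, $$N_k=\{h^+(\tau_k):h\in\mathcal L_0,\ \operatorname{supp}h\subset[\tau_k,b)\},\qquad N_{-k}=\{h^-(\tau_{-k}):h\in\mathcal L_0,\ \operatorname{supp}h\subset(a,\tau_{-k}]\}.$$ For $k\ge1$, $u$ satisfies condition $(k)$ if $u^+(\tau_k)\perp N_k$, and condition $(-k)$ if $u^-(\tau_{-k})\perp N_{-k}$. It satisfies condition $(0)$ if $u_0\perp N_0$, where $u_0$ is, by a choice fixed in advance, one of $u^+(\tau_0)$, $u^-(\tau_0)$, $u(\tau_0)$ (these coincide if $u$ is continuous at $\tau_0$). Then, for each of the three choices in condition $(0)$, the following holds. Suppose $u,f\in\mathcal L^2(w)$ and $([u],[f])\in T_{\max}$. Then there is a unique (as a function on $(a,b)$) balanced $v\in[u]$ of locally bounded variation such that $(v,f)\in\mathcal T_{\max}$ and $v$ satisfies condition $(k)$ for every $k\in\mathbb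 Z$. -/

import Mathlib

open MeasureTheory Set Filter Topology
open scoped ComplexOrder

noncomputable section

/-- `ℂⁿ` with its standard inner product. -/
abbrev Cn (n : ℕ) : Type := EuclideanSpace ℂ (Fin n)

/-- The open interval `(a,b)` of real numbers, where `-∞ ≤ a` and `b ≤ ∞`. -/
def openIvl (a b : EReal) : Set ℝ := {x | a < (x : EReal) ∧ (x : EReal) < b}

open Classical in
/-- The distributional derivative `F'` of a function `F` of locally bounded variation, as a complex
measure on the open interval `(c,d)` (for `[c,d]` contained in the interval where `F` is given).
It is the measure with mass `F⁻(y) - F⁻(x)` on `[x,y)` for `c < x ≤ y < d`; the clamped function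
`x ↦ F (max c (min d x))` only serves to discard the values of `F` outside of `[c,d]`. -/
def derivMeasure (F : ℝ → ℂ) (c d : ℝ) : ComplexMeasure ℝ :=
  if h : BoundedVariationOn (fun x => F (max c (min d x))) univ then
    VectorMeasure.restrict h.vectorMeasure (Ioo c d)
  else 0

/-- The matrix with entries `(M i j)'(B)`, for a Borel set `B ⊆ (c,d)`: the value on `B` of
the distribution of order zero with the antiderivative `M`, viewed as a matrix-valued measure. -/
def matMeasure {n : ℕ} (M : ℝ → Matrix (Fin n) (Fin n) ℂ) (c d : ℝ) (B : Set ℝ) :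
    Matrix (Fin n) (Fin n) ℂ :=
  Matrix.of fun i j => derivMeasure (fun x => M x i j) c d B

/-- The mass `M⁺(x) - M⁻(x)` at `x` of the derivative of `M`. -/
def jump {n : ℕ} (M : ℝ → Matrix (Fin n) (Fin n) ℂ) (x : ℝ) : Matrix (Fin n) (Fin n) ℂ :=
  Matrix.of fun i j =>
    Function.rightLim (fun y => M y i j) x - Function.leftLim (fun y => M y i j) x

/-- The data of the differential equation `J u' + q u = w f` on `(a,b)`. The matrices `q` and `w` of
distributions of order zero are given by antiderivatives `Q` and `W`, i.e., `q = Q'` and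
`w = W'` with functions `Q` and `W` of locally bounded variation on `(a,b)`. -/
structure DiffSystem (n : ℕ) (a b : EReal) where
  /-- the leading coefficient -/
  J : Matrix (Fin n) (Fin n) ℂ
  /-- an antiderivative of `q` -/
  Q : ℝ → Matrix (Fin n) (Fin n) ℂ
  /-- an antiderivative of `w` -/
  W : ℝ → Matrix (Fin n) (Fin n) ℂ
  J_isUnit : IsUnit J
  J_skew : J.conjTranspose = -J
  Q_bv : ∀ i j, LocallyBoundedVariationOn (fun x => Q x i j) (openIvl a b)
  W_bv : ∀ i j, LocallyBoundedVariationOn (fun x => W x i j) (openIvl a b)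
  /-- `q` is Hermitian -/
  q_herm : ∀ c ∈ openIvl a b, ∀ d ∈ openIvl a b, ∀ B : Set ℝ, MeasurableSet B → B ⊆ Ioo c d →
    (matMeasure Q c d B).IsHermitian
  /-- `w` is non-negative -/
  w_nonneg : ∀ c ∈ openIvl a b, ∀ d ∈ openIvl a b, ∀ B : Set ℝ, MeasurableSet B → B ⊆ Ioo c d →
    (matMeasure W c d B).PosSemidef

/-- `u` is a balanced function of locally bounded variation on `(a,b)`. -/
def BalancedBV {n : ℕ} (a b : EReal) (u : ℝ → Cn n) : Prop :=
  LocallyBoundedVariationOn u (openIvl a b) ∧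
    ∀ x ∈ openIvl a b, u x = (1 / 2 : ℂ) • (Function.rightLim u x + Function.leftLim u x)

namespace DiffSystem

variable {n : ℕ} {a b : EReal} (S : DiffSystem n a b)

/-! ### The measure `w`, the products `w f` and `q u`, the space `𝓛²(w)` -/

/-- The trace measure of `w` on `(c,d)`. The diagonal entries of `w` are non-negative, so each
of them is its own variation. -/
def traceMeasure (c d : ℝ) : Measure ℝ :=
  ∑ i, (derivMeasure (fun x => S.W x i i) c d).variation

/-- The Radon-Nikodym derivative of `w` with respect to its trace measure on `(c,d)`. -/
def density (c d : ℝ) (x : ℝ) : Matrix (Fin n) (Fin n) ℂ :=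
  Matrix.of fun i j =>
    (derivMeasure (fun y => S.W y i j) c d).rnDeriv (S.traceMeasure c d) x

/-- `∫ f* w f` over the interval `(c,d)`. -/
def normSqOn (f : ℝ → Cn n) (c d : ℝ) : ENNReal :=
  ∫⁻ x, ENNReal.ofReal
    (∑ i, ∑ j, (starRingEnd ℂ) (f x i) * S.density c d x i j * f x j).re ∂(S.traceMeasure c d)

/-- `‖f‖² = ∫ f* w f` over `(a,b)`, the supremum of the integrals over the intervals `(c,d)`
with `[c,d] ⊆ (a,b)`. -/
def normSq (f : ℝ → Cn n) : ENNReal :=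
  ⨆ c ∈ openIvl a b, ⨆ d ∈ openIvl a b, S.normSqOn f c d

/-- `f ∈ 𝓛²(w)`: `f` is measurable with respect to `w` and `∫ f* w f < ∞`. -/
def MemL2 (f : ℝ → Cn n) : Prop :=
  (∀ c ∈ openIvl a b, ∀ d ∈ openIvl a b, AEStronglyMeasurable f (S.traceMeasure c d)) ∧
    S.normSq f < ⊤

/-- The class `[u]` of `u ∈ 𝓛²(w)`: all `v ∈ 𝓛²(w)` with `‖v - u‖ = 0`. -/
def cls (u : ℝ → Cn n) : Set (ℝ → Cn n) :=
  {v | S.MemL2 v ∧ S.normSq (fun x => v x - u x) = 0}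

/-- The value of the `ℂⁿ`-valued measure `w f` on a Borel set `B ⊆ (c,d)`. -/
def wMul (f : ℝ → Cn n) (c d : ℝ) (B : Set ℝ) (i : Fin n) : ℂ :=
  ∫ x in B, (∑ j, S.density c d x i j * f x j) ∂(S.traceMeasure c d)

/-- The value of the `ℂⁿ`-valued measure `q u` on a Borel set `B ⊆ (c,d)`. -/
def qMul (u : ℝ → Cn n) (c d : ℝ) (B : Set ℝ) (i : Fin n) : ℂ :=
  ∑ j, VectorMeasure.integral
    (VectorMeasure.restrict (derivMeasure (fun x => S.Q x i j) c d) B)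
    (fun x => u x j) (ContinuousLinearMap.mul ℝ ℂ)

/-- The value of the `ℂⁿ`-valued measure `J u'` on a Borel set `B ⊆ (c,d)`. -/
def JDeriv (u : ℝ → Cn n) (c d : ℝ) (B : Set ℝ) (i : Fin n) : ℂ :=
  ∑ j, S.J i j * derivMeasure (fun x => u x j) c d B

/-! ### The differential equation and the maximal relation -/

/-- `J u' + q u = w f` on `(a,b)`: the two sides are distributions of order zero, and they agree
as measures on every interval `(c,d)` with `[c,d] ⊆ (a,b)`. -/
def Solves (u f : ℝ → Cn n) : Prop :=
  ∀ c ∈ openIvl a b, ∀ d ∈ openIvl a b, ∀ B : Set ℝ, MeasurableSet B → B ⊆ Ioo c d →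
    ∀ i, S.JDeriv u c d B i + S.qMul u c d B i = S.wMul f c d B i

/-- The maximal relation `𝓣_max` of pairs of functions. -/
def calTmax : Set ((ℝ → Cn n) × (ℝ → Cn n)) :=
  {p | S.MemL2 p.1 ∧ S.MemL2 p.2 ∧ BalancedBV a b p.1 ∧ S.Solves p.1 p.2}

/-- The maximal relation `T_max` of pairs of classes. -/
def Tmax : Set (Set (ℝ → Cn n) × Set (ℝ → Cn n)) :=
  {p | ∃ u f, (u, f) ∈ S.calTmax ∧ p = (S.cls u, S.cls f)}

/-- The space `𝓛₀` of balanced solutions of `J u' + q u = 0` with `‖u‖ = 0`. -/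
def L0 : Set (ℝ → Cn n) :=
  {u | BalancedBV a b u ∧ S.Solves u (fun _ => 0) ∧ S.normSq u = 0}

/-! ### The matrices `B_±(x,0)`, the set `Ξ₀` and the points `τ_k` -/

/-- `B_+(x,0) = J + Δ_q(x)/2`. -/
def Bplus (x : ℝ) : Matrix (Fin n) (Fin n) ℂ := S.J + (1 / 2 : ℂ) • jump S.Q x

/-- `B_-(x,0) = J - Δ_q(x)/2`. -/
def Bminus (x : ℝ) : Matrix (Fin n) (Fin n) ℂ := S.J - (1 / 2 : ℂ) • jump S.Q x

/-- The set `Ξ₀` of points `x` where `B_+(x,0)` or `B_-(x,0)` is not invertible. -/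
def Xi0 : Set ℝ := {x ∈ openIvl a b | (S.Bplus x).det * (S.Bminus x).det = 0}

/-- The requirements on the sequence `(τ_k)`, `k ∈ ℤ`: it is strictly increasing in `(a,b)`,
accumulates at `a` and `b` only, passes through all points of `Ξ₀`, and
`B_+(τ_0,0) = B_-(τ_0,0) = J`. -/
structure Admissible (τ : ℤ → ℝ) : Prop where
  strictMono : StrictMono τ
  mem : ∀ k, τ k ∈ openIvl a b
  tendsto_left : Tendsto (fun k => (τ k : EReal)) atBot (𝓝 a)
  tendsto_right : Tendsto (fun k => (τ k : EReal)) atTop (𝓝 b)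
  Xi0_subset : S.Xi0 ⊆ range τ
  Bplus_zero : S.Bplus (τ 0) = S.J
  Bminus_zero : S.Bminus (τ 0) = S.J

end DiffSystem

/-! ### The spaces `N_k` and the conditions `(k)` -/

/-- The three values attached to a function at a point: `u⁻(x)`, `u(x)` and `u⁺(x)`. -/
inductive Side where
  | minus
  | center
  | plus

/-- `u⁻(x)`, `u(x)` or `u⁺(x)`. -/
def Side.eval {n : ℕ} : Side → (ℝ → Cn n) → ℝ → Cn n
  | Side.minus, u, x => Function.leftLim u x
  | Side.center, u, x => u x
  | Side.plus, u, x => Function.rightLim u x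

namespace DiffSystem

variable {n : ℕ} {a b : EReal} (S : DiffSystem n a b)

/-- `N_0 = {h(τ_0) : h ∈ 𝓛₀}`, and for `k > 0`
`N_k = {h⁺(τ_k) : h ∈ 𝓛₀, supp h ⊆ [τ_k,b)}`,
`N_{-k} = {h⁻(τ_{-k}) : h ∈ 𝓛₀, supp h ⊆ (a,τ_{-k}]}`. -/
def N (τ : ℤ → ℝ) (k : ℤ) : Set (Cn n) :=
  if 0 < k then
    {y | ∃ h ∈ S.L0, (∀ x ∈ openIvl a b, x < τ k → h x = 0) ∧ y = Function.rightLim h (τ k)}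
  else if k < 0 then
    {y | ∃ h ∈ S.L0, (∀ x ∈ openIvl a b, τ k < x → h x = 0) ∧ y = Function.leftLim h (τ k)}
  else {y | ∃ h ∈ S.L0, y = h (τ 0)}

/-- Condition `(k)`: for `k > 0` the vector `u⁺(τ_k)`, and for `k < 0` the vector `u⁻(τ_k)`, is
perpendicular to `N_k`. For `k = 0` the vector is the one given by the parameter `s`, one of
`u⁻(τ_0)`, `u(τ_0)`, `u⁺(τ_0)`; these coincide when `u` is continuous at `τ_0`. -/
def Cond (s : Side) (τ : ℤ → ℝ) (k : ℤ) (u : ℝ → Cn n) : Prop :=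
  ∀ y ∈ S.N τ k,
    inner ℂ y ((if 0 < k then Side.plus else if k < 0 then Side.minus else s).eval u (τ k)) = 0

end DiffSystem

end

noncomputable section

open scoped Matrix

/-! ### Functions of bounded variation -/

section BoundedVariation

variable {E : Type*} [NormedAddCommGroup E]

/-! The admissible representatives of `[u]` that solve the equation with right-hand side `w f` form
a coset of `𝓛₀`: adding an element of `𝓛₀` changes neither the class nor the equation, and two such
representatives differ by an element of `𝓛₀` (`sub_mem_L0`). Replacing `f` within its class does not
change `w f`. It remains to show that every balanced `u` can be moved into all the conditions by an
element of `𝓛₀`, and that an element of `𝓛₀` satisfying all of them is zero.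

Existence (`exists_forall_cond`). Each `N_k` is a linear subspace of `ℂⁿ`, so an orthogonal
projection (`exists_sub_orthogonal`) yields an element of `𝓛₀` whose subtraction enforces condition
`(k)`. For `k ≠ 0` this element is supported on the far side of `τ_k` as seen from `τ_0`, so
conditions closer to `τ_0` survive. Working outwards, the corrections stabilise on every compact
subinterval, and their limit stays in `𝓛₀` because membership is a local property
(`mem_L0_of_forall_exists`).

Uniqueness (`eqOn_zero_of_forall_cond`). If `h ∈ 𝓛₀` satisfies all conditions, then `h(τ_0)` is
orthogonal to itself and vanishes. Zeros propagate across `(τ_k, τ_{k+1})` by unique continuation,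
since there both `B_+` and `B_-` are invertible. At `τ_k` propagation may fail, but for `k > 0` the
part of `h` beyond `τ_k` is itself in `𝓛₀` (`mem_L0_of_glue`), so `h⁺(τ_k)` lies in `N_k` and is
orthogonal to `N_k`; hence it is zero and the argument continues. The left side is symmetric.

Unique continuation rests on a contraction estimate (`eq_zero_of_qMass_le`): next to a point where
the relevant one-sided limit of `h` vanishes, `h' = -J⁻¹ q h` and the small mass of `q` force `h =
0`. The jump relation `B_+ h⁺ = B_- h⁻` carries zeros through the points outside `Ξ₀`. -/

theorem BoundedVariationOn.add {f g : ℝ → E} {s : Set ℝ} (hf : BoundedVariationOn f s)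
    (hg : BoundedVariationOn g s) : BoundedVariationOn (fun x => f x + g x) s := by
  refine ne_top_of_le_ne_top (ENNReal.add_ne_top.2 ⟨hf, hg⟩) (iSup_le fun p => ?_)
  calc _ ≤ ∑ i ∈ Finset.range p.1, (edist (f (p.2.1 (i + 1))) (f (p.2.1 i)) +
          edist (g (p.2.1 (i + 1))) (g (p.2.1 i))) :=
        Finset.sum_le_sum fun i _ => edist_add_add_le _ _ _ _
    _ ≤ _ := by
      rw [Finset.sum_add_distrib]
      exact add_le_add (eVariationOn.sum_le p.2.2.1 p.2.2.2)
        (eVariationOn.sum_le p.2.2.1 p.2.2.2)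

theorem BoundedVariationOn.const_smul {f : ℝ → E} {s : Set ℝ} [NormedSpace ℂ E] (z : ℂ)
    (hf : BoundedVariationOn f s) : BoundedVariationOn (fun x => z • f x) s :=
  (lipschitzWith_smul z).comp_boundedVariationOn hf

theorem BoundedVariationOn.clamp {f : ℝ → E} {c d : ℝ} (hcd : c ≤ d)
    (hf : BoundedVariationOn f (Icc c d)) :
    BoundedVariationOn (fun x => f (max c (min d x))) univ := by
  refine ne_top_of_le_ne_top hf (eVariationOn.comp_le_of_monotoneOn f
    (fun x => max c (min d x)) ?_ ?_)
  · intro x _ y _ hxy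
    exact max_le_max_left _ (min_le_min_left _ hxy)
  · intro x _
    exact ⟨le_max_left _ _, max_le hcd (min_le_left _ _)⟩

theorem clamp_eq {c d x : ℝ} (hx : x ∈ Icc c d) : max c (min d x) = x := by
  rw [min_eq_right hx.2, max_eq_right hx.1]

theorem BoundedVariationOn.tendsto_rightLim_of_mem [CompleteSpace E] {f : ℝ → E} {c d x : ℝ}
    (hf : BoundedVariationOn f (Icc c d)) (hx : x ∈ Ico c d) :
    Tendsto f (𝓝[>] x) (𝓝 (Function.rightLim f x)) := by
  obtain ⟨l, hl⟩ := hf.exists_tendsto_right x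
  have : 𝓝[>] x ≤ 𝓝[Icc c d ∩ Ioi x] x := by
    rw [← nhdsWithin_Ioo_eq_nhdsGT hx.2]
    exact nhdsWithin_mono _ fun y hy => ⟨⟨hx.1.trans hy.1.le, hy.2.le⟩, hy.1⟩
  rw [rightLim_eq_of_tendsto (hl.mono_left this)]
  exact hl.mono_left this

theorem BoundedVariationOn.tendsto_leftLim_of_mem [CompleteSpace E] {f : ℝ → E} {c d x : ℝ}
    (hf : BoundedVariationOn f (Icc c d)) (hx : x ∈ Ioc c d) :
    Tendsto f (𝓝[<] x) (𝓝 (Function.leftLim f x)) := by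
  obtain ⟨l, hl⟩ := hf.exists_tendsto_left x
  have : 𝓝[<] x ≤ 𝓝[Icc c d ∩ Iio x] x := by
    rw [← nhdsWithin_Ioo_eq_nhdsLT hx.1]
    exact nhdsWithin_mono _ fun y hy => ⟨⟨hy.1.le, hy.2.le.trans hx.2⟩, hy.2⟩
  rw [leftLim_eq_of_tendsto (hl.mono_left this)]
  exact hl.mono_left this

theorem leftLim_clamp [CompleteSpace E] {f : ℝ → E} {c d x : ℝ}
    (hf : BoundedVariationOn f (Icc c d)) (hx : x ∈ Ioc c d) :
    Function.leftLim (fun x => f (max c (min d x))) x = Function.leftLim f x := by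
  refine leftLim_eq_of_tendsto ((hf.tendsto_leftLim_of_mem hx).congr' ?_)
  filter_upwards [Ioo_mem_nhdsLT hx.1] with y hy
  rw [clamp_eq ⟨hy.1.le, hy.2.le.trans hx.2⟩]

theorem rightLim_clamp [CompleteSpace E] {f : ℝ → E} {c d x : ℝ}
    (hf : BoundedVariationOn f (Icc c d)) (hx : x ∈ Ico c d) :
    Function.rightLim (fun x => f (max c (min d x))) x = Function.rightLim f x := by
  refine rightLim_eq_of_tendsto ((hf.tendsto_rightLim_of_mem hx).congr' ?_)
  filter_upwards [Ioo_mem_nhdsGT hx.2] with y hy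
  rw [clamp_eq ⟨hx.1.trans hy.1.le, hy.2.le⟩]

theorem BoundedVariationOn.exists_norm_le {f : ℝ → E} {s : Set ℝ}
    (hf : BoundedVariationOn f s) : ∃ C, ∀ x ∈ s, ‖f x‖ ≤ C := by
  rcases s.eq_empty_or_nonempty with rfl | ⟨y, hy⟩
  · exact ⟨0, by simp⟩
  refine ⟨‖f y‖ + (eVariationOn f s).toReal, fun x hx => ?_⟩
  have := hf.dist_le hx hy
  rw [dist_eq_norm] at this
  calc ‖f x‖ = ‖f y + (f x - f y)‖ := by abel_nf
    _ ≤ _ := (norm_add_le _ _).trans (by gcongr)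

theorem BoundedVariationOn.measurable_real {f : ℝ → ℝ} (hf : BoundedVariationOn f univ) :
    Measurable f := by
  obtain ⟨p, q, hp, hq, rfl⟩ :=
    hf.locallyBoundedVariationOn.exists_monotoneOn_sub_monotoneOn
  exact (monotoneOn_univ.1 hp).measurable.sub (monotoneOn_univ.1 hq).measurable

theorem BoundedVariationOn.measurable_complex {f : ℝ → ℂ} (hf : BoundedVariationOn f univ) :
    Measurable f := by
  have hre : LipschitzWith 1 Complex.re := by
    refine LipschitzWith.of_dist_le_mul fun x y => ?_
    rw [Real.dist_eq, dist_eq_norm, ← Complex.sub_re]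
    simpa using Complex.abs_re_le_norm (x - y)
  have him : LipschitzWith 1 Complex.im := by
    refine LipschitzWith.of_dist_le_mul fun x y => ?_
    rw [Real.dist_eq, dist_eq_norm, ← Complex.sub_im]
    simpa using Complex.abs_im_le_norm (x - y)
  exact measurable_of_re_im (hre.comp_boundedVariationOn hf).measurable_real
    (him.comp_boundedVariationOn hf).measurable_real

end BoundedVariation

/-! ### The measure `F'` -/

/-- The variation is dominated by the sum of the total variations of the real and imaginary parts,
which are finite. -/
theorem ComplexMeasure.variation_univ_lt_top (μ : ComplexMeasure ℝ) :
    μ.variation univ < ⊤ := by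
  have h : μ.variation ≤ (ComplexMeasure.re μ).totalVariation +
      (ComplexMeasure.im μ).totalVariation := by
    refine VectorMeasure.variation_le_of_forall_enorm_le fun E _ => ?_
    have h1 := SignedMeasure.enorm_le_totalVariation (ComplexMeasure.re μ) E
    have h2 := SignedMeasure.enorm_le_totalVariation (ComplexMeasure.im μ) E
    refine le_trans ?_ (add_le_add h1 h2)
    have h3 : (ComplexMeasure.re μ) E = (μ E).re := rfl
    have h4 : (ComplexMeasure.im μ) E = (μ E).im := rfl
    rw [h3, h4, enorm_eq_nnnorm, enorm_eq_nnnorm, enorm_eq_nnnorm, ← ENNReal.coe_add,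
      ENNReal.coe_le_coe, ← NNReal.coe_le_coe]
    simpa using Complex.norm_le_abs_re_add_abs_im (μ E)
  refine (h univ).trans_lt ?_
  rw [Measure.coe_add, Pi.add_apply]
  have (s : SignedMeasure ℝ) : s.totalVariation univ < ⊤ := by
    rw [SignedMeasure.totalVariation]
    exact measure_lt_top _ _
  exact ENNReal.add_lt_top.2 ⟨this _, this _⟩

instance (μ : ComplexMeasure ℝ) : IsFiniteMeasure μ.variation :=
  ⟨ComplexMeasure.variation_univ_lt_top μ⟩

theorem derivMeasure_of_bv {F : ℝ → ℂ} {c d : ℝ} (hcd : c ≤ d)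
    (hF : BoundedVariationOn F (Icc c d)) :
    derivMeasure F c d = VectorMeasure.restrict (hF.clamp hcd).vectorMeasure (Ioo c d) := by
  rw [derivMeasure, dif_pos]

theorem derivMeasure_inter (F : ℝ → ℂ) (c d : ℝ) {B : Set ℝ} (hB : MeasurableSet B) :
    derivMeasure F c d (B ∩ Ioo c d) = derivMeasure F c d B := by
  unfold derivMeasure
  split_ifs
  · rw [VectorMeasure.restrict_apply _ measurableSet_Ioo hB,
      VectorMeasure.restrict_apply _ measurableSet_Ioo (hB.inter measurableSet_Ioo)]
    congr 1
    ext x; simp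
  · rfl

theorem derivMeasure_restrict_Ioo (F : ℝ → ℂ) (c d : ℝ) :
    VectorMeasure.restrict (derivMeasure F c d) (Ioo c d) = derivMeasure F c d := by
  ext B hB
  rw [VectorMeasure.restrict_apply _ measurableSet_Ioo hB, derivMeasure_inter F c d hB]

section

variable {F G : ℝ → ℂ} {c d : ℝ}

theorem derivMeasure_apply_of_subset (hcd : c ≤ d) (hF : BoundedVariationOn F (Icc c d))
    {B : Set ℝ} (hB : MeasurableSet B) (hBcd : B ⊆ Ioo c d) :
    derivMeasure F c d B = (hF.clamp hcd).vectorMeasure B := by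
  rw [derivMeasure_of_bv hcd hF, VectorMeasure.restrict_apply _ measurableSet_Ioo hB,
    inter_eq_left.2 hBcd]

theorem derivMeasure_Ioo {x y : ℝ} (hF : BoundedVariationOn F (Icc c d)) (hcx : c ≤ x)
    (hxy : x < y) (hyd : y ≤ d) :
    derivMeasure F c d (Ioo x y) = Function.leftLim F y - Function.rightLim F x := by
  rw [derivMeasure_apply_of_subset (hcx.trans (hxy.le.trans hyd)) hF measurableSet_Ioo
    (Ioo_subset_Ioo hcx hyd), BoundedVariationOn.vectorMeasure_Ioo _ hxy,
    leftLim_clamp hF ⟨hcx.trans_lt hxy, hyd⟩, rightLim_clamp hF ⟨hcx, hxy.trans_le hyd⟩]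

theorem derivMeasure_Ioc {x y : ℝ} (hF : BoundedVariationOn F (Icc c d)) (hcx : c ≤ x)
    (hxy : x < y) (hyd : y < d) :
    derivMeasure F c d (Ioc x y) = Function.rightLim F y - Function.rightLim F x := by
  rw [derivMeasure_apply_of_subset (hcx.trans (hxy.le.trans hyd.le)) hF measurableSet_Ioc
    (fun z hz => ⟨hcx.trans_lt hz.1, hz.2.trans_lt hyd⟩),
    BoundedVariationOn.vectorMeasure_Ioc _ hxy.le,
    rightLim_clamp hF ⟨hcx.trans hxy.le, hyd⟩, rightLim_clamp hF ⟨hcx, hxy.trans hyd⟩]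

theorem derivMeasure_Ico {x y : ℝ} (hF : BoundedVariationOn F (Icc c d)) (hcx : c < x)
    (hxy : x < y) (hyd : y ≤ d) :
    derivMeasure F c d (Ico x y) = Function.leftLim F y - Function.leftLim F x := by
  rw [derivMeasure_apply_of_subset (hcx.le.trans (hxy.le.trans hyd)) hF measurableSet_Ico
    (fun z hz => ⟨hcx.trans_le hz.1, hz.2.trans_le hyd⟩),
    BoundedVariationOn.vectorMeasure_Ico _ hxy.le,
    leftLim_clamp hF ⟨hcx.trans hxy, hyd⟩, leftLim_clamp hF ⟨hcx, hxy.le.trans hyd⟩]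

theorem derivMeasure_singleton {x : ℝ} (hF : BoundedVariationOn F (Icc c d))
    (hx : x ∈ Ioo c d) :
    derivMeasure F c d {x} = Function.rightLim F x - Function.leftLim F x := by
  rw [derivMeasure_apply_of_subset (hx.1.trans hx.2).le hF (measurableSet_singleton x)
    (by simpa using hx), BoundedVariationOn.vectorMeasure_singleton,
    leftLim_clamp hF ⟨hx.1, hx.2.le⟩, rightLim_clamp hF ⟨hx.1.le, hx.2⟩]

/-- Complex measures on an open interval are determined by their values on the open
subintervals. -/
theorem VectorMeasure.apply_eq_of_Ioo {μ ν : ComplexMeasure ℝ}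
    (h : ∀ x y, c ≤ x → x < y → y ≤ d → μ (Ioo x y) = ν (Ioo x y)) {B : Set ℝ}
    (hB : MeasurableSet B) (hBcd : B ⊆ Ioo c d) : μ B = ν B := by
  have key : μ.restrict (Ioo c d) = ν.restrict (Ioo c d) := by
    refine VectorMeasure.ext_of_generateFrom
      (⋃ (p : ℚ) (q : ℚ) (_ : p < q), {Ioo (p : ℝ) (q : ℝ)}) ?_ ?_
      Real.isPiSystem_Ioo_rat ?_
    · intro s hs
      simp only [mem_iUnion, mem_singleton_iff] at hs
      obtain ⟨p, q, _, rfl⟩ := hs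
      rw [VectorMeasure.restrict_apply _ measurableSet_Ioo measurableSet_Ioo,
        VectorMeasure.restrict_apply _ measurableSet_Ioo measurableSet_Ioo, Ioo_inter_Ioo]
      rcases lt_or_ge ((p : ℝ) ⊔ c) ((q : ℝ) ⊓ d) with h1 | h1
      · exact h _ _ le_sup_right h1 inf_le_right
      · rw [Ioo_eq_empty (not_lt.2 h1)]; simp
    · rw [← Real.borel_eq_generateFrom_Ioo_rat]
      exact BorelSpace.measurable_eq
    · rw [VectorMeasure.restrict_apply_univ, VectorMeasure.restrict_apply_univ]
      rcases lt_or_ge c d with h1 | h1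
      · exact h _ _ le_rfl h1 le_rfl
      · rw [Ioo_eq_empty (not_lt.2 h1)]; simp
  have := congrArg (fun m : ComplexMeasure ℝ => m B) key
  simpa [VectorMeasure.restrict_apply _ measurableSet_Ioo hB, inter_eq_left.2 hBcd] using this

/-- The value of `F'` on `B` only depends on the values of `F` on an open interval
containing `B`. -/
theorem derivMeasure_congr {c' d' : ℝ} (hF : BoundedVariationOn F (Icc c d))
    (hG : BoundedVariationOn G (Icc c' d')) {x y : ℝ} (hFG : EqOn F G (Ioo x y))
    (hcx : c ≤ x) (hcx' : c' ≤ x) (hyd : y ≤ d) (hyd' : y ≤ d')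
    {B : Set ℝ} (hB : MeasurableSet B) (hBxy : B ⊆ Ioo x y) :
    derivMeasure F c d B = derivMeasure G c' d' B := by
  refine VectorMeasure.apply_eq_of_Ioo (c := x) (d := y) (fun s t hs hst ht => ?_) hB hBxy
  rw [derivMeasure_Ioo hF (hcx.trans hs) hst (ht.trans hyd),
    derivMeasure_Ioo hG (hcx'.trans hs) hst (ht.trans hyd')]
  have h1 : Function.leftLim F t = Function.leftLim G t := by
    refine leftLim_eq_of_tendsto ((hG.tendsto_leftLim_of_mem
      ⟨(hcx'.trans hs).trans_lt hst, ht.trans hyd'⟩).congr' ?_)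
    filter_upwards [Ioo_mem_nhdsLT hst] with z hz
    exact (hFG ⟨hs.trans_lt hz.1, hz.2.trans_le ht⟩).symm
  have h2 : Function.rightLim F s = Function.rightLim G s := by
    refine rightLim_eq_of_tendsto ((hG.tendsto_rightLim_of_mem
      ⟨hcx'.trans hs, hst.trans_le (ht.trans hyd')⟩).congr' ?_)
    filter_upwards [Ioo_mem_nhdsGT hst] with z hz
    exact (hFG ⟨hs.trans_lt hz.1, hz.2.trans_le ht⟩).symm
  rw [h1, h2]

theorem derivMeasure_add_smul (hF : BoundedVariationOn F (Icc c d))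
    (hG : BoundedVariationOn G (Icc c d)) (z : ℂ) {B : Set ℝ} (hB : MeasurableSet B)
    (hBcd : B ⊆ Ioo c d) :
    derivMeasure (fun x => F x + z * G x) c d B =
      derivMeasure F c d B + z * derivMeasure G c d B := by
  have hsum : BoundedVariationOn (fun x => F x + z * G x) (Icc c d) :=
    hF.add (hG.const_smul z)
  change _ = (derivMeasure F c d + z • derivMeasure G c d) B
  refine VectorMeasure.apply_eq_of_Ioo (fun s t hs hst ht => ?_) hB hBcd
  change _ = derivMeasure F c d (Ioo s t) + z * derivMeasure G c d (Ioo s t)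
  rw [derivMeasure_Ioo hsum hs hst ht, derivMeasure_Ioo hF hs hst ht,
    derivMeasure_Ioo hG hs hst ht]
  have ht' : t ∈ Ioc c d := ⟨hs.trans_lt hst, ht⟩
  have hs' : s ∈ Ico c d := ⟨hs, hst.trans_le ht⟩
  rw [leftLim_eq_of_tendsto ((hF.tendsto_leftLim_of_mem ht').add
      ((hG.tendsto_leftLim_of_mem ht').const_mul z)),
    rightLim_eq_of_tendsto ((hF.tendsto_rightLim_of_mem hs').add
      ((hG.tendsto_rightLim_of_mem hs').const_mul z))]
  ring

end

/-! ### Integrals of functions of bounded variation -/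

theorem BoundedVariationOn.aestronglyMeasurable {F : ℝ → ℂ} {c d : ℝ}
    (hF : BoundedVariationOn F (Icc c d)) (μ : Measure ℝ) {B : Set ℝ} (hB : MeasurableSet B)
    (hBcd : B ⊆ Icc c d) : AEStronglyMeasurable F (μ.restrict B) := by
  rcases B.eq_empty_or_nonempty with rfl | ⟨x, hx⟩
  · simp
  have hcd : c ≤ d := (hBcd hx).1.trans (hBcd hx).2
  refine (hF.clamp hcd).measurable_complex.aestronglyMeasurable.congr ?_
  filter_upwards [ae_restrict_mem hB] with y hy
  rw [clamp_eq (hBcd hy)]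

theorem BoundedVariationOn.integrableOn {F : ℝ → ℂ} {c d : ℝ}
    (hF : BoundedVariationOn F (Icc c d)) (μ : ComplexMeasure ℝ) {B : Set ℝ}
    (hB : MeasurableSet B) (hBcd : B ⊆ Icc c d) : μ.IntegrableOn F B := by
  obtain ⟨C, hC⟩ := hF.exists_norm_le
  change Integrable F (μ.restrict B).variation
  rw [VectorMeasure.variation_restrict hB]
  refine Integrable.of_bound (hF.aestronglyMeasurable _ hB hBcd) C ?_
  filter_upwards [ae_restrict_mem hB] with y hy
  exact hC y (hBcd hy)

theorem integral_const_mul_mul (μ : ComplexMeasure ℝ) (z : ℂ) {F : ℝ → ℂ}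
    (hF : μ.Integrable F) :
    VectorMeasure.integral μ (fun x => z * F x) (ContinuousLinearMap.mul ℝ ℂ) =
      z * VectorMeasure.integral μ F (ContinuousLinearMap.mul ℝ ℂ) := by
  have h1 := VectorMeasure.integral_continuousLinearMap_comp (μ := μ)
    (B := ContinuousLinearMap.mul ℝ ℂ) (C := ContinuousLinearMap.mul ℝ ℂ z) hF
  have h2 := VectorMeasure.continuousLinearMap_apply_integral (μ := μ)
    (B := ContinuousLinearMap.mul ℝ ℂ) (C := ContinuousLinearMap.mul ℝ ℂ z) hF
  simp only [ContinuousLinearMap.mul_apply'] at h1 h2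
  rw [h1, h2]
  congr 1
  ext; simp [mul_assoc]

/-! ### The interval `(a,b)` -/

section openIvl

variable {a b : EReal} {c d : ℝ}

theorem isOpen_openIvl : IsOpen (openIvl a b) :=
  isOpen_Ioo.preimage continuous_coe_real_ereal

theorem Icc_subset_openIvl (hc : c ∈ openIvl a b) (hd : d ∈ openIvl a b) :
    Icc c d ⊆ openIvl a b := fun _ hx =>
  ⟨hc.1.trans_le (EReal.coe_le_coe_iff.2 hx.1), (EReal.coe_le_coe_iff.2 hx.2).trans_lt hd.2⟩

theorem exists_lt_mem_openIvl {x : ℝ} (hx : x ∈ openIvl a b) : ∃ c ∈ openIvl a b, c < x := by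
  have := (isOpen_openIvl (a := a) (b := b)).mem_nhds hx
  obtain ⟨ε, hε, h⟩ := Metric.mem_nhds_iff.1 this
  exact ⟨x - ε / 2, h (by rw [Real.ball_eq_Ioo]; constructor <;> linarith), by linarith⟩

theorem exists_gt_mem_openIvl {x : ℝ} (hx : x ∈ openIvl a b) : ∃ c ∈ openIvl a b, x < c := by
  have := (isOpen_openIvl (a := a) (b := b)).mem_nhds hx
  obtain ⟨ε, hε, h⟩ := Metric.mem_nhds_iff.1 this
  exact ⟨x + ε / 2, h (by rw [Real.ball_eq_Ioo]; constructor <;> linarith), by linarith⟩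

theorem LocallyBoundedVariationOn.icc {E : Type*} [NormedAddCommGroup E] {f : ℝ → E}
    (hf : LocallyBoundedVariationOn f (openIvl a b)) (hc : c ∈ openIvl a b)
    (hd : d ∈ openIvl a b) : BoundedVariationOn f (Icc c d) := by
  have := hf c d hc hd
  rwa [inter_eq_right.2 (Icc_subset_openIvl hc hd)] at this

theorem locallyBoundedVariationOn_openIvl {E : Type*} [NormedAddCommGroup E] {f : ℝ → E}
    (hf : ∀ c ∈ openIvl a b, ∀ d ∈ openIvl a b, BoundedVariationOn f (Icc c d)) :
    LocallyBoundedVariationOn f (openIvl a b) := by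
  intro c d hc hd
  rw [inter_eq_right.2 (Icc_subset_openIvl hc hd)]
  exact hf c hc d hd

theorem tendsto_rightLim_openIvl {E : Type*} [NormedAddCommGroup E] [CompleteSpace E]
    {f : ℝ → E} (hf : LocallyBoundedVariationOn f (openIvl a b)) {x : ℝ}
    (hx : x ∈ openIvl a b) : Tendsto f (𝓝[>] x) (𝓝 (Function.rightLim f x)) := by
  obtain ⟨d, hd, hxd⟩ := exists_gt_mem_openIvl hx
  exact (hf.icc hx hd).tendsto_rightLim_of_mem ⟨le_rfl, hxd⟩

theorem tendsto_leftLim_openIvl {E : Type*} [NormedAddCommGroup E] [CompleteSpace E]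
    {f : ℝ → E} (hf : LocallyBoundedVariationOn f (openIvl a b)) {x : ℝ}
    (hx : x ∈ openIvl a b) : Tendsto f (𝓝[<] x) (𝓝 (Function.leftLim f x)) := by
  obtain ⟨c, hc, hcx⟩ := exists_lt_mem_openIvl hx
  exact (hf.icc hc hx).tendsto_leftLim_of_mem ⟨hcx, le_rfl⟩

end openIvl

theorem BoundedVariationOn.apply {n : ℕ} {u : ℝ → Cn n} {s : Set ℝ}
    (hu : BoundedVariationOn u s) (j : Fin n) : BoundedVariationOn (fun x => u x j) s := by
  have : LipschitzWith 1 (fun v : Cn n => v j) := by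
    refine LipschitzWith.of_dist_le_mul fun x y => ?_
    rw [dist_eq_norm, dist_eq_norm]
    simpa using PiLp.norm_apply_le (x - y) j
  exact this.comp_boundedVariationOn hu

theorem tendsto_apply {n : ℕ} {u : ℝ → Cn n} {l : Filter ℝ} {v : Cn n}
    (h : Tendsto u l (𝓝 v)) (j : Fin n) : Tendsto (fun x => u x j) l (𝓝 (v j)) :=
  ((EuclideanSpace.proj (𝕜 := ℂ) j).continuous.tendsto v).comp h

/-! ### The left-hand side of the differential equation -/

namespace DiffSystem

variable {n : ℕ} {a b : EReal} (S : DiffSystem n a b) {u v : ℝ → Cn n} {c d c' d' : ℝ}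
  {B : Set ℝ}

/-- The value of `J u' + q u` on `B ⊆ (c,d)`. -/
def lhs (u : ℝ → Cn n) (c d : ℝ) (B : Set ℝ) (i : Fin n) : ℂ :=
  S.JDeriv u c d B i + S.qMul u c d B i

theorem lhs_add_smul (hu : BoundedVariationOn u (Icc c d)) (hv : BoundedVariationOn v (Icc c d))
    (z : ℂ) (hB : MeasurableSet B) (hBcd : B ⊆ Ioo c d) (i : Fin n) :
    S.lhs (fun x => u x + z • v x) c d B i = S.lhs u c d B i + z * S.lhs v c d B i := by
  have h1 : S.JDeriv (fun x => u x + z • v x) c d B i =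
      S.JDeriv u c d B i + z * S.JDeriv v c d B i := by
    simp only [JDeriv, Finset.mul_sum, ← Finset.sum_add_distrib]
    refine Finset.sum_congr rfl fun j _ => ?_
    have := derivMeasure_add_smul (hu.apply j) (hv.apply j) z hB hBcd
    simp only [PiLp.add_apply, PiLp.smul_apply, smul_eq_mul]
    rw [this]; ring
  have h2 : S.qMul (fun x => u x + z • v x) c d B i =
      S.qMul u c d B i + z * S.qMul v c d B i := by
    simp only [qMul, Finset.mul_sum, ← Finset.sum_add_distrib]
    refine Finset.sum_congr rfl fun j _ => ?_
    have hBcd' := hBcd.trans Ioo_subset_Icc_self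
    have iu := (hu.apply j).integrableOn (derivMeasure (fun x => S.Q x i j) c d) hB hBcd'
    have iv := (hv.apply j).integrableOn (derivMeasure (fun x => S.Q x i j) c d) hB hBcd'
    simp only [PiLp.add_apply, PiLp.smul_apply, smul_eq_mul]
    rw [VectorMeasure.integral_fun_add iu (iv.const_mul z), integral_const_mul_mul _ z iv]
  simp only [lhs, h1, h2]
  ring

/-- Locality of `J u' + q u`: its value on `B` depends neither on the window `(c,d)` nor on `u` away
from an open interval containing `B`. Gluing arguments rest on this. -/
theorem lhs_congr (hc : c ∈ openIvl a b) (hd : d ∈ openIvl a b) (hc' : c' ∈ openIvl a b)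
    (hd' : d' ∈ openIvl a b) (hu : BoundedVariationOn u (Icc c d))
    (hv : BoundedVariationOn v (Icc c' d')) {x y : ℝ} (huv : EqOn u v (Ioo x y))
    (hcx : c ≤ x) (hcx' : c' ≤ x) (hyd : y ≤ d) (hyd' : y ≤ d') (hB : MeasurableSet B)
    (hBxy : B ⊆ Ioo x y) (i : Fin n) : S.lhs u c d B i = S.lhs v c' d' B i := by
  have h1 : S.JDeriv u c d B i = S.JDeriv v c' d' B i := by
    refine Finset.sum_congr rfl fun j _ => ?_
    rw [derivMeasure_congr (hu.apply j) (hv.apply j) (x := x) (y := y)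
      (fun z hz => by simp only [huv hz]) hcx hcx' hyd hyd' hB hBxy]
  have h2 : S.qMul u c d B i = S.qMul v c' d' B i := by
    refine Finset.sum_congr rfl fun j _ => ?_
    have : VectorMeasure.restrict (derivMeasure (fun x => S.Q x i j) c d) B =
        VectorMeasure.restrict (derivMeasure (fun x => S.Q x i j) c' d') B := by
      ext E hE
      rw [VectorMeasure.restrict_apply _ hB hE, VectorMeasure.restrict_apply _ hB hE]
      exact derivMeasure_congr ((S.Q_bv i j).icc hc hd) ((S.Q_bv i j).icc hc' hd')
        (x := x) (y := y) (fun _ _ => rfl) hcx hcx' hyd hyd' (hE.inter hB)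
        (inter_subset_right.trans hBxy)
    rw [this]
    exact VectorMeasure.setIntegral_congr_fun fun z hz => by simp only [huv (hBxy hz)]
  rw [lhs, lhs, h1, h2]

theorem lhs_union (hu : BoundedVariationOn u (Icc c d)) {B' : Set ℝ} (hB : MeasurableSet B)
    (hB' : MeasurableSet B') (hBB' : Disjoint B B') (hBcd : B ⊆ Ioo c d)
    (hBcd' : B' ⊆ Ioo c d) (i : Fin n) :
    S.lhs u c d (B ∪ B') i = S.lhs u c d B i + S.lhs u c d B' i := by
  have h1 : S.JDeriv u c d (B ∪ B') i = S.JDeriv u c d B i + S.JDeriv u c d B' i := by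
    simp only [JDeriv, ← Finset.sum_add_distrib]
    refine Finset.sum_congr rfl fun j _ => ?_
    rw [VectorMeasure.of_union hBB' hB hB', mul_add]
  have h2 : S.qMul u c d (B ∪ B') i = S.qMul u c d B i + S.qMul u c d B' i := by
    simp only [qMul, ← Finset.sum_add_distrib]
    refine Finset.sum_congr rfl fun j _ => ?_
    exact VectorMeasure.setIntegral_union hBB' hB hB'
      ((hu.apply j).integrableOn _ hB (hBcd.trans Ioo_subset_Icc_self))
      ((hu.apply j).integrableOn _ hB' (hBcd'.trans Ioo_subset_Icc_self))
  rw [lhs, lhs, lhs, h1, h2]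
  ring

theorem norm_qMul_le {M : ℝ} (hM : ∀ x ∈ B, ∀ j, ‖u x j‖ ≤ M) (i : Fin n) :
    ‖S.qMul u c d B i‖ ≤
      M * ∑ j, (derivMeasure (fun x => S.Q x i j) c d).variation.real B := by
  rw [qMul, Finset.mul_sum]
  refine (norm_sum_le _ _).trans (Finset.sum_le_sum fun j _ => ?_)
  have := VectorMeasure.norm_setIntegral_le_of_norm_le_const
    (μ := derivMeasure (fun x => S.Q x i j) c d) (B := ContinuousLinearMap.mul ℝ ℂ)
    (fun x hx => hM x hx j)
  simpa using this

theorem qMul_singleton (hc : c ∈ openIvl a b) (hd : d ∈ openIvl a b) {x : ℝ}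
    (hx : x ∈ Ioo c d) (i : Fin n) :
    S.qMul u c d {x} i = ∑ j, jump S.Q x i j * u x j := by
  refine Finset.sum_congr rfl fun j _ => ?_
  rw [VectorMeasure.integral_singleton, derivMeasure_singleton ((S.Q_bv i j).icc hc hd) hx]
  simp [jump, mul_comm]

end DiffSystem

/-! ### Positivity of the matrix density of `w` -/

theorem ae_nonneg_of_forall_setIntegral_nonneg_complex {μ : Measure ℝ} {g : ℝ → ℂ}
    (hg : Integrable g μ) (h : ∀ B, MeasurableSet B → 0 ≤ ∫ x in B, g x ∂μ) :
    ∀ᵐ x ∂μ, 0 ≤ g x := by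
  have hre (B : Set ℝ) : ∫ x in B, (g x).re ∂μ = (∫ x in B, g x ∂μ).re :=
    integral_re hg.integrableOn
  have him (B : Set ℝ) : ∫ x in B, (g x).im ∂μ = (∫ x in B, g x ∂μ).im :=
    integral_im hg.integrableOn
  have h1 : 0 ≤ᵐ[μ] fun x => (g x).re :=
    ae_nonneg_of_forall_setIntegral_nonneg hg.re fun B hB _ => by
      rw [hre]; exact (Complex.le_def.1 (h B hB)).1
  have h2 : (fun x => (g x).im) =ᵐ[μ] 0 :=
    hg.im.ae_eq_zero_of_forall_setIntegral_eq_zero fun B hB _ => by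
      change ∫ x in B, (g x).im ∂μ = 0
      rw [him]; exact (Complex.le_def.1 (h B hB)).2.symm
  filter_upwards [h1, h2] with x hx1 hx2
  exact Complex.le_def.2 ⟨hx1, hx2.symm⟩

namespace DiffSystem

variable {n : ℕ} {a b : EReal} (S : DiffSystem n a b) {c d : ℝ}

instance : IsFiniteMeasure (S.traceMeasure c d) := by
  constructor
  rw [traceMeasure, Measure.finsetSum_apply]
  exact ENNReal.sum_lt_top.2 fun i _ => measure_lt_top _ _

theorem ae_mem_Ioo : ∀ᵐ x ∂S.traceMeasure c d, x ∈ Ioo c d := by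
  have h : S.traceMeasure c d (Ioo c d)ᶜ = 0 := by
    rw [traceMeasure, Measure.finsetSum_apply]
    refine Finset.sum_eq_zero fun i _ => ?_
    rw [← derivMeasure_restrict_Ioo, VectorMeasure.variation_restrict measurableSet_Ioo,
      Measure.restrict_apply measurableSet_Ioo.compl, compl_inter_self, measure_empty]
  exact h

/-- A positive semidefinite matrix with zero trace is zero. Hence every entry of `w`, not only the
diagonal ones, is absolutely continuous with respect to the trace measure, and its density recovers
it completely. -/
theorem derivMeasure_W_eq_zero (hc : c ∈ openIvl a b) (hd : d ∈ openIvl a b) {B : Set ℝ}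
    (hB : MeasurableSet B) (h : S.traceMeasure c d B = 0) (i j : Fin n) :
    derivMeasure (fun x => S.W x i j) c d B = 0 := by
  have hdiag (i : Fin n) : derivMeasure (fun x => S.W x i i) c d B = 0 := by
    rw [traceMeasure, Measure.finsetSum_apply, Finset.sum_eq_zero_iff] at h
    exact (VectorMeasure.variation_apply_eq_zero hB).1 (h i (Finset.mem_univ i)) B
      Subset.rfl hB
  have hpsd := S.w_nonneg c hc d hd (B ∩ Ioo c d) (hB.inter measurableSet_Ioo)
    inter_subset_right
  have hz : matMeasure S.W c d (B ∩ Ioo c d) = 0 := by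
    rw [← hpsd.trace_eq_zero_iff]
    refine Finset.sum_eq_zero fun i _ => ?_
    simp only [matMeasure, Matrix.diag_apply, Matrix.of_apply]
    rw [derivMeasure_inter _ _ _ hB, hdiag]
  rw [← derivMeasure_inter _ _ _ hB]
  exact congrFun (congrFun hz i) j

theorem integrable_density (i j : Fin n) :
    Integrable (fun x => S.density c d x i j) (S.traceMeasure c d) :=
  ComplexMeasure.integrable_rnDeriv _ _

theorem setIntegral_density (hc : c ∈ openIvl a b) (hd : d ∈ openIvl a b) {B : Set ℝ}
    (hB : MeasurableSet B) (i j : Fin n) :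
    ∫ x in B, S.density c d x i j ∂S.traceMeasure c d =
      matMeasure S.W c d (B ∩ Ioo c d) i j := by
  simp only [matMeasure, Matrix.of_apply]
  rw [derivMeasure_inter _ _ _ hB]
  set w := derivMeasure (fun x => S.W x i j) c d with hw
  have hre : ComplexMeasure.re w ≪ᵥ (S.traceMeasure c d).toENNRealVectorMeasure := by
    refine VectorMeasure.AbsolutelyContinuous.mk fun s hs h0 => ?_
    rw [Measure.toENNRealVectorMeasure_apply_measurable hs] at h0
    change (w s).re = 0
    rw [hw, S.derivMeasure_W_eq_zero hc hd hs h0, Complex.zero_re]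
  have him : ComplexMeasure.im w ≪ᵥ (S.traceMeasure c d).toENNRealVectorMeasure := by
    refine VectorMeasure.AbsolutelyContinuous.mk fun s hs h0 => ?_
    rw [Measure.toENNRealVectorMeasure_apply_measurable hs] at h0
    change (w s).im = 0
    rw [hw, S.derivMeasure_W_eq_zero hc hd hs h0, Complex.zero_im]
  have hint : Integrable (fun x => S.density c d x i j) (S.traceMeasure c d) :=
    S.integrable_density i j
  apply Complex.ext
  · have h1 : ∫ x in B, (S.density c d x i j).re ∂S.traceMeasure c d =
        (∫ x in B, S.density c d x i j ∂S.traceMeasure c d).re := integral_re hint.integrableOn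
    rw [← h1]
    have h2 := SignedMeasure.withDensityᵥ_rnDeriv_eq _ _ hre
    have h3 := congrArg (fun m : SignedMeasure ℝ => m B) h2
    rw [withDensityᵥ_apply (SignedMeasure.integrable_rnDeriv _ _) hB] at h3
    exact h3
  · have h1 : ∫ x in B, (S.density c d x i j).im ∂S.traceMeasure c d =
        (∫ x in B, S.density c d x i j ∂S.traceMeasure c d).im := integral_im hint.integrableOn
    rw [← h1]
    have h2 := SignedMeasure.withDensityᵥ_rnDeriv_eq _ _ him
    have h3 := congrArg (fun m : SignedMeasure ℝ => m B) h2
    rw [withDensityᵥ_apply (SignedMeasure.integrable_rnDeriv _ _) hB] at h3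
    exact h3

/-- The density of `w` is almost everywhere positive semidefinite. -/
theorem ae_posSemidef_density (hc : c ∈ openIvl a b) (hd : d ∈ openIvl a b) :
    ∀ᵐ x ∂S.traceMeasure c d, (S.density c d x).PosSemidef := by
  have hpsd (B : Set ℝ) (hB : MeasurableSet B) :
      (matMeasure S.W c d (B ∩ Ioo c d)).PosSemidef :=
    S.w_nonneg c hc d hd (B ∩ Ioo c d) (hB.inter measurableSet_Ioo) inter_subset_right
  have hherm : ∀ᵐ x ∂S.traceMeasure c d, ∀ i j,
      star (S.density c d x j i) = S.density c d x i j := by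
    refine ae_all_iff.2 fun i => ae_all_iff.2 fun j => ?_
    have hconj : Integrable (fun x => star (S.density c d x j i)) (S.traceMeasure c d) :=
      (Complex.conjLIE.integrable_comp_iff (φ := fun x => S.density c d x j i)).2
        (S.integrable_density j i)
    refine hconj.ae_eq_of_forall_setIntegral_eq _ _ (S.integrable_density i j)
      fun B hB _ => ?_
    have h1 : ∫ x in B, star (S.density c d x j i) ∂S.traceMeasure c d =
      star (∫ x in B, S.density c d x j i ∂S.traceMeasure c d) := integral_conj
    rw [h1, S.setIntegral_density hc hd hB, S.setIntegral_density hc hd hB]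
    exact (hpsd B hB).1.apply i j
  have hpos (z : Fin n → ℂ) :
      ∀ᵐ x ∂S.traceMeasure c d, 0 ≤ star z ⬝ᵥ (S.density c d x *ᵥ z) := by
    have hterm (i j : Fin n) :
        Integrable (fun x => star (z i) * (S.density c d x i j * z j)) (S.traceMeasure c d) :=
      ((S.integrable_density i j).mul_const _).const_mul _
    have heq (M : Matrix (Fin n) (Fin n) ℂ) :
        star z ⬝ᵥ (M *ᵥ z) = ∑ i, ∑ j, star (z i) * (M i j * z j) := by
      simp [dotProduct, Matrix.mulVec, Finset.mul_sum]
    simp only [heq]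
    refine ae_nonneg_of_forall_setIntegral_nonneg_complex
      (integrable_finsetSum _ fun i _ => integrable_finsetSum _ fun j _ => hterm i j)
      fun B hB => ?_
    rw [integral_finsetSum _ fun i _ =>
      (integrable_finsetSum _ fun j _ => hterm i j).integrableOn]
    have : ∀ i, ∫ x in B, ∑ j, star (z i) * (S.density c d x i j * z j) ∂S.traceMeasure c d =
        ∑ j, star (z i) * (matMeasure S.W c d (B ∩ Ioo c d) i j * z j) := fun i => by
      rw [integral_finsetSum _ fun j _ => (hterm i j).integrableOn]
      refine Finset.sum_congr rfl fun j _ => ?_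
      rw [integral_const_mul, integral_mul_const, S.setIntegral_density hc hd hB]
    rw [Finset.sum_congr rfl fun i _ => this i, ← heq]
    exact (hpsd B hB).dotProduct_mulVec_nonneg z
  -- The exceptional null set in `hpos` depends on `z`. A countable dense set of vectors gives a
  -- common null set, and continuity of the quadratic form then covers all `z`.
  have hall : ∀ᵐ x ∂S.traceMeasure c d, ∀ k, 0 ≤
      star (TopologicalSpace.denseSeq (Fin n → ℂ) k) ⬝ᵥ
        (S.density c d x *ᵥ TopologicalSpace.denseSeq (Fin n → ℂ) k) :=
    ae_all_iff.2 fun k => hpos _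
  filter_upwards [hherm, hall] with x hx1 hx2
  refine Matrix.PosSemidef.of_dotProduct_mulVec_nonneg (Matrix.IsHermitian.ext hx1) ?_
  have hclosed : IsClosed {z : Fin n → ℂ | 0 ≤ star z ⬝ᵥ (S.density c d x *ᵥ z)} := by
    refine isClosed_Ici.preimage (f := fun z : Fin n → ℂ => star z ⬝ᵥ (S.density c d x *ᵥ z)) ?_
    simp only [dotProduct, Matrix.mulVec, Pi.star_apply]
    fun_prop
  intro z
  exact hclosed.closure_subset_iff.2 (range_subset_iff.2 hx2)
    ((TopologicalSpace.denseRange_denseSeq (Fin n → ℂ)) z)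

/-! ### Functions of norm zero -/

/-- `w g = 0`. -/
def Null (g : ℝ → Cn n) : Prop :=
  ∀ c ∈ openIvl a b, ∀ d ∈ openIvl a b, ∀ᵐ x ∂S.traceMeasure c d,
    S.density c d x *ᵥ (fun j => g x j) = 0

/-- Measurability with respect to `w`. -/
def WMeas (g : ℝ → Cn n) : Prop :=
  ∀ c ∈ openIvl a b, ∀ d ∈ openIvl a b, AEStronglyMeasurable g (S.traceMeasure c d)

variable {S} {f g : ℝ → Cn n}

theorem Null.add_smul (hf : S.Null f) (hg : S.Null g) (z : ℂ) :
    S.Null (fun x => f x + z • g x) := by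
  intro c hc d hd
  filter_upwards [hf c hc d hd, hg c hc d hd] with x h1 h2
  have : (fun j => (f x + z • g x) j) = (fun j => f x j) + z • (fun j => g x j) := rfl
  rw [this, Matrix.mulVec_add, Matrix.mulVec_smul, h1, h2, smul_zero, add_zero]

theorem Null.sub (hf : S.Null f) (hg : S.Null g) : S.Null (fun x => f x - g x) := by
  simpa [sub_eq_add_neg] using hf.add_smul hg (-1)

theorem sum_eq_dotProduct (M : Matrix (Fin n) (Fin n) ℂ) (v : Fin n → ℂ) :
    ∑ i, ∑ j, (starRingEnd ℂ) (v i) * M i j * v j = star v ⬝ᵥ (M *ᵥ v) := by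
  simp [dotProduct, Matrix.mulVec, Finset.mul_sum, mul_assoc]

/-- With `D` the density, `D g = 0` almost everywhere, and `g* D = (D g)* = 0` because `D` is
Hermitian; so all terms containing `g` drop out. -/
theorem Null.normSq_add_eq (hg : S.Null g) (f : ℝ → Cn n) :
    S.normSq (fun x => f x + g x) = S.normSq f := by
  unfold normSq
  refine iSup_congr fun c => iSup_congr fun hc => iSup_congr fun d => iSup_congr fun hd => ?_
  refine lintegral_congr_ae ?_
  filter_upwards [hg c hc d hd, S.ae_posSemidef_density hc hd] with x h1 h2
  rw [sum_eq_dotProduct _ (fun j => (f x + g x) j), sum_eq_dotProduct _ (fun j => f x j)]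
  have : (fun j => (f x + g x) j) = (fun j => f x j) + (fun j => g x j) := rfl
  rw [this, Matrix.mulVec_add, h1, add_zero, star_add, add_dotProduct,
    Matrix.dotProduct_mulVec (star fun j => g x j),
    show (star fun j => g x j) ᵥ* S.density c d x = 0 by
      rw [← h2.1.eq, ← Matrix.star_mulVec, h1, star_zero], zero_dotProduct, add_zero]

theorem Null.normSq_eq_zero (hg : S.Null g) : S.normSq g = 0 := by
  have h := hg.normSq_add_eq (fun _ => 0)
  simp only [zero_add] at h
  rw [h]
  simp [normSq, normSqOn]

/-- For a positive semidefinite `D`, `g* D g = 0` forces `D g = 0`. This turns the quadratic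
condition `‖g‖ = 0` into the linear, local condition `w g = 0`. -/
theorem null_of_normSq_eq_zero (hm : S.WMeas g) (h : S.normSq g = 0) : S.Null g := by
  intro c hc d hd
  have h0 : S.normSqOn g c d = 0 := by
    refine le_antisymm (le_trans ?_ h.le) zero_le
    unfold normSq
    exact le_iSup₂_of_le c hc (le_iSup₂_of_le d hd le_rfl)
  have hg (j : Fin n) : AEMeasurable (fun x => g x j) (S.traceMeasure c d) :=
    ((EuclideanSpace.proj (𝕜 := ℂ) j).continuous.comp_aestronglyMeasurable
      (hm c hc d hd)).aemeasurable
  have hD (i j : Fin n) : AEMeasurable (fun x => S.density c d x i j) (S.traceMeasure c d) :=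
    (S.integrable_density i j).aemeasurable
  have hmeas : AEMeasurable (fun x => ENNReal.ofReal
      (∑ i, ∑ j, (starRingEnd ℂ) (g x i) * S.density c d x i j * g x j).re)
      (S.traceMeasure c d) := by
    refine ENNReal.measurable_ofReal.comp_aemeasurable
      (Complex.measurable_re.comp_aemeasurable ?_)
    refine Finset.aemeasurable_fun_sum _ fun i _ => Finset.aemeasurable_fun_sum _ fun j _ => ?_
    exact ((Complex.continuous_conj.measurable.comp_aemeasurable (hg i)).mul (hD i j)).mul (hg j)
  have := (lintegral_eq_zero_iff' hmeas).1 h0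
  filter_upwards [this, S.ae_posSemidef_density hc hd] with x h1 h2
  rw [sum_eq_dotProduct _ (fun j => g x j)] at h1
  rw [← h2.dotProduct_mulVec_zero_iff]
  have h3 := h2.dotProduct_mulVec_nonneg (fun j => g x j)
  have h4 := (Complex.le_def.1 h3)
  have h5 : (star (fun j => g x j) ⬝ᵥ S.density c d x *ᵥ fun j => g x j).re ≤ 0 := by
    simpa using h1
  exact Complex.ext (le_antisymm h5 h4.1) h4.2.symm

theorem Null.wMul_eq (h : S.Null (fun x => f x - g x)) (hc : c ∈ openIvl a b)
    (hd : d ∈ openIvl a b) (B : Set ℝ) (i : Fin n) :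
    S.wMul f c d B i = S.wMul g c d B i := by
  refine integral_congr_ae (ae_restrict_of_ae ?_)
  filter_upwards [h c hc d hd] with x hx
  have := congrFun hx i
  simp only [Matrix.mulVec, dotProduct, PiLp.sub_apply, mul_sub, Finset.sum_sub_distrib,
    Pi.zero_apply] at this
  exact sub_eq_zero.1 this

theorem wMul_zero (B : Set ℝ) (i : Fin n) :
    S.wMul (fun _ => 0) c d B i = 0 := by
  simp [wMul]

theorem WMeas.of_bv (h : LocallyBoundedVariationOn f (openIvl a b)) : S.WMeas f := by
  intro c hc d hd
  have hr : S.traceMeasure c d = (S.traceMeasure c d).restrict (Ioo c d) :=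
    (Measure.restrict_eq_self_of_ae_mem S.ae_mem_Ioo).symm
  rw [hr]
  have hj (j : Fin n) : AEStronglyMeasurable (fun x => f x j)
      ((S.traceMeasure c d).restrict (Ioo c d)) :=
    ((h.icc hc hd).apply j).aestronglyMeasurable _ measurableSet_Ioo Ioo_subset_Icc_self
  have h2 : AEStronglyMeasurable (fun x => fun j => f x j)
      ((S.traceMeasure c d).restrict (Ioo c d)) :=
    (aemeasurable_pi_lambda _ fun j => (hj j).aemeasurable).aestronglyMeasurable
  exact (PiLp.continuous_toLp 2 (fun _ : Fin n => ℂ)).comp_aestronglyMeasurable h2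

end DiffSystem

theorem leftLim_congr_nhds {E : Type*} [TopologicalSpace E] [T2Space E] {f g : ℝ → E} {x : ℝ}
    (h : f =ᶠ[𝓝 x] g) : Function.leftLim f x = Function.leftLim g x := by
  have h' : f =ᶠ[𝓝[<] x] g := h.filter_mono nhdsWithin_le_nhds
  by_cases hy : ∃ y, Tendsto g (𝓝[<] x) (𝓝 y)
  · obtain ⟨y, hy⟩ := hy
    rw [leftLim_eq_of_tendsto hy, leftLim_eq_of_tendsto (hy.congr' h'.symm)]
  -- Without a limit, `leftLim` defaults to the value at `x`; this is why agreement on a full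
  -- neighbourhood, including `x`, is assumed.
  · rw [leftLim_eq_of_not_tendsto g hy, leftLim_eq_of_not_tendsto f
      fun ⟨y, hf⟩ => hy ⟨y, hf.congr' h'⟩, h.self_of_nhds]

theorem rightLim_congr_nhds {E : Type*} [TopologicalSpace E] [T2Space E] {f g : ℝ → E} {x : ℝ}
    (h : f =ᶠ[𝓝 x] g) : Function.rightLim f x = Function.rightLim g x := by
  have h' : f =ᶠ[𝓝[>] x] g := h.filter_mono nhdsWithin_le_nhds
  by_cases hy : ∃ y, Tendsto g (𝓝[>] x) (𝓝 y)
  · obtain ⟨y, hy⟩ := hy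
    rw [rightLim_eq_of_tendsto hy, rightLim_eq_of_tendsto (hy.congr' h'.symm)]
  · rw [rightLim_eq_of_not_tendsto g hy, rightLim_eq_of_not_tendsto f
      fun ⟨y, hf⟩ => hy ⟨y, hf.congr' h'⟩, h.self_of_nhds]

/-! ### Balanced functions -/

namespace BalancedBV

variable {n : ℕ} {a b : EReal} {u v : ℝ → Cn n} {x : ℝ}

theorem tendsto_right (hu : BalancedBV a b u) (hx : x ∈ openIvl a b) :
    Tendsto u (𝓝[>] x) (𝓝 (Function.rightLim u x)) :=
  tendsto_rightLim_openIvl hu.1 hx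

theorem tendsto_left (hu : BalancedBV a b u) (hx : x ∈ openIvl a b) :
    Tendsto u (𝓝[<] x) (𝓝 (Function.leftLim u x)) :=
  tendsto_leftLim_openIvl hu.1 hx

theorem rightLim_add_smul (hu : BalancedBV a b u) (hv : BalancedBV a b v) (z : ℂ)
    (hx : x ∈ openIvl a b) : Function.rightLim (fun x => u x + z • v x) x =
      Function.rightLim u x + z • Function.rightLim v x :=
  rightLim_eq_of_tendsto ((hu.tendsto_right hx).add ((hv.tendsto_right hx).const_smul z))

theorem leftLim_add_smul (hu : BalancedBV a b u) (hv : BalancedBV a b v) (z : ℂ)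
    (hx : x ∈ openIvl a b) : Function.leftLim (fun x => u x + z • v x) x =
      Function.leftLim u x + z • Function.leftLim v x :=
  leftLim_eq_of_tendsto ((hu.tendsto_left hx).add ((hv.tendsto_left hx).const_smul z))

theorem add_smul (hu : BalancedBV a b u) (hv : BalancedBV a b v) (z : ℂ) :
    BalancedBV a b (fun x => u x + z • v x) := by
  refine ⟨fun c d hc hd => (hu.1 c d hc hd).add ((hv.1 c d hc hd).const_smul z), ?_⟩
  intro x hx
  rw [hu.rightLim_add_smul hv z hx, hu.leftLim_add_smul hv z hx]
  change u x + z • v x = _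
  rw [hu.2 x hx, hv.2 x hx]
  module

theorem zero : BalancedBV a b (fun _ => (0 : Cn n)) := by
  refine ⟨locallyBoundedVariationOn_openIvl fun c _ d _ => ?_, fun x _ => ?_⟩
  · have : eVariationOn (fun _ => (0 : Cn n)) (Icc c d) = 0 :=
      eVariationOn.constant_on fun x hx y hy => by
        obtain ⟨_, _, rfl⟩ := hx
        obtain ⟨_, _, rfl⟩ := hy
        rfl
    rw [BoundedVariationOn, this]
    exact ENNReal.zero_ne_top
  · rw [rightLim_eq_of_tendsto (tendsto_const_nhds (x := (0 : Cn n))),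
      leftLim_eq_of_tendsto (tendsto_const_nhds (x := (0 : Cn n)))]
    simp

/-- Being balanced is a local property. -/
theorem of_local (hbv : LocallyBoundedVariationOn u (openIvl a b))
    (h : ∀ x ∈ openIvl a b, ∃ v, BalancedBV a b v ∧ u =ᶠ[𝓝 x] v) : BalancedBV a b u := by
  refine ⟨hbv, fun x hx => ?_⟩
  obtain ⟨v, hv, huv⟩ := h x hx
  rw [huv.self_of_nhds, rightLim_congr_nhds huv, leftLim_congr_nhds huv]
  exact hv.2 x hx

end BalancedBV

namespace DiffSystem

variable {n : ℕ} {a b : EReal} {S : DiffSystem n a b} {u v f g h : ℝ → Cn n}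

/-! ### The space `𝓛₀` -/

/-- Bounded variation gives the measurability needed to replace `‖u‖ = 0` by `w u = 0`; in this form
linearity and locality of `𝓛₀` are direct. -/
theorem mem_L0_iff : u ∈ S.L0 ↔ BalancedBV a b u ∧
    (∀ c ∈ openIvl a b, ∀ d ∈ openIvl a b, ∀ B : Set ℝ, MeasurableSet B → B ⊆ Ioo c d →
      ∀ i, S.lhs u c d B i = 0) ∧ S.Null u := by
  constructor
  · rintro ⟨h1, h2, h3⟩
    refine ⟨h1, fun c hc d hd B hB hBcd i => ?_, null_of_normSq_eq_zero (WMeas.of_bv h1.1) h3⟩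
    exact (h2 c hc d hd B hB hBcd i).trans (wMul_zero B i)
  · rintro ⟨h1, h2, h3⟩
    refine ⟨h1, fun c hc d hd B hB hBcd i => ?_, h3.normSq_eq_zero⟩
    exact (h2 c hc d hd B hB hBcd i).trans (wMul_zero B i).symm

theorem add_smul_mem_L0 (hu : u ∈ S.L0) (hv : v ∈ S.L0) (z : ℂ) :
    (fun x => u x + z • v x) ∈ S.L0 := by
  rw [mem_L0_iff] at hu hv ⊢
  refine ⟨hu.1.add_smul hv.1 z, fun c hc d hd B hB hBcd i => ?_, hu.2.2.add_smul hv.2.2 z⟩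
  rw [S.lhs_add_smul (hu.1.1.icc hc hd) (hv.1.1.icc hc hd) z hB hBcd,
    hu.2.1 c hc d hd B hB hBcd, hv.2.1 c hc d hd B hB hBcd]
  simp

theorem zero_mem_L0 : (fun _ => (0 : Cn n)) ∈ S.L0 := by
  refine mem_L0_iff.2 ⟨BalancedBV.zero, fun c hc d hd B hB hBcd i => ?_, fun c _ d _ => ?_⟩
  · have hz := (BalancedBV.zero (n := n) (a := a) (b := b)).1.icc hc hd
    have := S.lhs_add_smul hz hz 1 hB hBcd i
    simpa using this
  · refine Eventually.of_forall fun x => ?_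
    have : (fun j => (0 : Cn n) j) = 0 := rfl
    rw [this, Matrix.mulVec_zero]

theorem Solves.add_smul_L0 (hu : BalancedBV a b u) (hs : S.Solves u f) (hv : v ∈ S.L0) (z : ℂ) :
    S.Solves (fun x => u x + z • v x) f := by
  rw [mem_L0_iff] at hv
  intro c hc d hd B hB hBcd i
  have := S.lhs_add_smul (hu.1.icc hc hd) (hv.1.1.icc hc hd) z hB hBcd i
  rw [hv.2.1 c hc d hd B hB hBcd, mul_zero, add_zero] at this
  exact this.trans (hs c hc d hd B hB hBcd i)

theorem sub_mem_L0 (hu : BalancedBV a b u) (hv : BalancedBV a b v) (hsu : S.Solves u f)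
    (hsv : S.Solves v f) (hnull : S.Null (fun x => u x - v x)) :
    (fun x => u x - v x) ∈ S.L0 := by
  have hsub : (fun x => u x - v x) = fun x => u x + (-1 : ℂ) • v x := by
    funext x; simp [sub_eq_add_neg]
  rw [hsub] at hnull ⊢
  refine mem_L0_iff.2 ⟨hu.add_smul hv (-1), fun c hc d hd B hB hBcd i => ?_, hnull⟩
  rw [S.lhs_add_smul (hu.1.icc hc hd) (hv.1.icc hc hd) _ hB hBcd]
  have h1 : S.lhs u c d B i = S.wMul f c d B i := hsu c hc d hd B hB hBcd i
  have h2 : S.lhs v c d B i = S.wMul f c d B i := hsv c hc d hd B hB hBcd i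
  rw [h1, h2]
  ring

theorem null_of_forall_exists (h : ∀ c ∈ openIvl a b, ∀ d ∈ openIvl a b,
    ∃ v, S.Null v ∧ EqOn g v (Icc c d)) : S.Null g := by
  intro c hc d hd
  obtain ⟨v, hv, hgv⟩ := h c hc d hd
  filter_upwards [hv c hc d hd, S.ae_mem_Ioo] with x hx hxcd
  rwa [hgv (Ioo_subset_Icc_self hxcd)]

/-- Bounded variation, balancedness, the equation and `w g = 0` are all tested on compact
subintervals, so a different witness may serve for each of them. -/
theorem mem_L0_of_forall_exists (h : ∀ c ∈ openIvl a b, ∀ d ∈ openIvl a b,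
    ∃ v ∈ S.L0, EqOn g v (Icc c d)) : g ∈ S.L0 := by
  have hbv : LocallyBoundedVariationOn g (openIvl a b) :=
    locallyBoundedVariationOn_openIvl fun c hc d hd => by
      obtain ⟨v, hv, hgv⟩ := h c hc d hd
      rw [BoundedVariationOn, eVariationOn.eq_of_eqOn hgv]
      exact hv.1.1.icc hc hd
  refine mem_L0_iff.2 ⟨BalancedBV.of_local hbv fun x hx => ?_, fun c hc d hd B hB hBcd i => ?_,
    null_of_forall_exists fun c hc d hd => ?_⟩
  · obtain ⟨c, hc, hcx⟩ := exists_lt_mem_openIvl hx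
    obtain ⟨d, hd, hxd⟩ := exists_gt_mem_openIvl hx
    obtain ⟨v, hv, hgv⟩ := h c hc d hd
    refine ⟨v, hv.1, ?_⟩
    filter_upwards [Icc_mem_nhds hcx hxd] with y hy using hgv hy
  · obtain ⟨v, hv, hgv⟩ := h c hc d hd
    rw [S.lhs_congr hc hd hc hd (hbv.icc hc hd) (hv.1.1.icc hc hd)
      (hgv.mono Ioo_subset_Icc_self) le_rfl le_rfl le_rfl le_rfl hB hBcd]
    exact (mem_L0_iff.1 hv).2.1 c hc d hd B hB hBcd i
  · obtain ⟨v, hv, hgv⟩ := h c hc d hd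
    exact ⟨v, (mem_L0_iff.1 hv).2.2, hgv⟩

/-- Two elements of `𝓛₀` which agree on `(p,r)` can be glued. -/
theorem mem_L0_of_glue {p r : ℝ} (hp : p ∈ openIvl a b) (hr : r ∈ openIvl a b) (hpr : p < r)
    (hu : u ∈ S.L0) (hv : v ∈ S.L0) (hgu : ∀ x ∈ openIvl a b, x < r → g x = u x)
    (hgv : ∀ x ∈ openIvl a b, p < x → g x = v x) : g ∈ S.L0 := by
  -- Cutting strictly inside the overlap leaves each half within an open interval on which `g`
  -- coincides with `u` or with `v`, as locality requires.
  obtain ⟨m, hpm, hmr⟩ := exists_between hpr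
  have hm : m ∈ openIvl a b := Icc_subset_openIvl hp hr ⟨hpm.le, hmr.le⟩
  have enlarge : ∀ c ∈ openIvl a b, ∀ d ∈ openIvl a b, ∃ c' ∈ openIvl a b,
      ∃ d' ∈ openIvl a b, c' ≤ c ∧ c' ≤ p ∧ d ≤ d' ∧ r ≤ d' := fun c hc d hd =>
    ⟨min c p, by rcases min_choice c p with h | h <;> rwa [h], max d r,
      by rcases max_choice d r with h | h <;> rwa [h], min_le_left _ _, min_le_right _ _,
      le_max_left _ _, le_max_right _ _⟩
  have hbv : LocallyBoundedVariationOn g (openIvl a b) := by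
    refine locallyBoundedVariationOn_openIvl fun c hc d hd => ?_
    obtain ⟨c', hc', d', hd', hcc', hcp, hdd', hrd⟩ := enlarge c hc d hd
    refine BoundedVariationOn.mono ?_ (Icc_subset_Icc hcc' hdd')
    have := eVariationOn.Icc_add_Icc g (s := univ) (hcp.trans hpm.le) (hmr.le.trans hrd)
      (mem_univ m)
    simp only [univ_inter] at this
    rw [BoundedVariationOn, ← this]
    refine ENNReal.add_ne_top.2 ⟨?_, ?_⟩
    · rw [eVariationOn.eq_of_eqOn fun x hx => hgu x (Icc_subset_openIvl hc' hm hx)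
        (hx.2.trans_lt hmr)]
      exact hu.1.1.icc hc' hm
    · rw [eVariationOn.eq_of_eqOn fun x hx => hgv x (Icc_subset_openIvl hm hd' hx)
        (hpm.trans_le hx.1)]
      exact hv.1.1.icc hm hd'
  refine mem_L0_iff.2 ⟨BalancedBV.of_local hbv fun x hx => ?_, fun c hc d hd B hB hBcd i => ?_,
    fun c hc d hd => ?_⟩
  · rcases lt_or_ge x r with hxr | hxr
    · refine ⟨u, hu.1, ?_⟩
      filter_upwards [isOpen_openIvl.mem_nhds hx, Iio_mem_nhds hxr] with y hy hyr
        using hgu y hy hyr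
    · refine ⟨v, hv.1, ?_⟩
      filter_upwards [isOpen_openIvl.mem_nhds hx, Ioi_mem_nhds (hpr.trans_le hxr)] with y hy hyr
        using hgv y hy hyr
  · obtain ⟨c', hc', d', hd', hcc', hcp, hdd', hrd⟩ := enlarge c hc d hd
    have hg' := hbv.icc hc' hd'
    have hB' : B ⊆ Ioo c' d' := hBcd.trans (Ioo_subset_Ioo hcc' hdd')
    rw [S.lhs_congr hc hd hc' hd' (hbv.icc hc hd) hg' (fun _ _ => rfl) le_rfl hcc' le_rfl hdd'
      hB hBcd, ← inter_union_sdiff B (Iic m), S.lhs_union hg' (hB.inter measurableSet_Iic)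
      (hB.diff measurableSet_Iic) disjoint_sdiff_inter.symm
      (inter_subset_left.trans hB') (sdiff_subset.trans hB')]
    rw [S.lhs_congr hc' hd' hc' hd' hg' (hu.1.1.icc hc' hd') (x := c') (y := r)
        (fun x hx => hgu x (Icc_subset_openIvl hc' hr (Ioo_subset_Icc_self hx)) hx.2)
        le_rfl le_rfl hrd hrd (hB.inter measurableSet_Iic)
        (fun x hx => ⟨(hB' hx.1).1, lt_of_le_of_lt hx.2 hmr⟩),
      S.lhs_congr hc' hd' hc' hd' hg' (hv.1.1.icc hc' hd') (x := p) (y := d')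
        (fun x hx => hgv x (Icc_subset_openIvl hp hd' (Ioo_subset_Icc_self hx)) hx.1)
        hcp hcp le_rfl le_rfl (hB.diff measurableSet_Iic)
        (fun x hx => ⟨hpm.trans (not_le.1 hx.2), (hB' hx.1).2⟩),
      (mem_L0_iff.1 hu).2.1 c' hc' d' hd' _ (hB.inter measurableSet_Iic)
        (inter_subset_left.trans hB'),
      (mem_L0_iff.1 hv).2.1 c' hc' d' hd' _ (hB.diff measurableSet_Iic)
        (sdiff_subset.trans hB'), add_zero]
  · filter_upwards [(mem_L0_iff.1 hu).2.2 c hc d hd, (mem_L0_iff.1 hv).2.2 c hc d hd,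
      S.ae_mem_Ioo] with x hxu hxv hx
    have hx' := Icc_subset_openIvl hc hd (Ioo_subset_Icc_self hx)
    rcases lt_or_ge x r with hxr | hxr
    · rwa [hgu x hx' hxr]
    · rwa [hgv x hx' (hpr.trans_le hxr)]

/-! ### Uniqueness for initial value problems -/

/-- The mass of the equation at the single point `x` is `J (h⁺ - h⁻) + Δ_q (h⁺ + h⁻)/2 = 0`, since
`h` is balanced; it remains to regroup. -/
theorem Bplus_mulVec_rightLim (hh : h ∈ S.L0) {x : ℝ} (hx : x ∈ openIvl a b) :
    S.Bplus x *ᵥ (fun j => Function.rightLim h x j) =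
      S.Bminus x *ᵥ (fun j => Function.leftLim h x j) := by
  obtain ⟨c, hc, hcx⟩ := exists_lt_mem_openIvl hx
  obtain ⟨d, hd, hxd⟩ := exists_gt_mem_openIvl hx
  funext i
  have h0 := (mem_L0_iff.1 hh).2.1 c hc d hd {x} (measurableSet_singleton x)
    (by simpa using ⟨hcx, hxd⟩) i
  have hbv := hh.1.1.icc hc hd
  rw [lhs, S.qMul_singleton hc hd ⟨hcx, hxd⟩, JDeriv, ← Finset.sum_add_distrib] at h0
  rw [← sub_eq_zero, ← h0]
  simp only [Matrix.mulVec, dotProduct, ← Finset.sum_sub_distrib]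
  refine Finset.sum_congr rfl fun j _ => ?_
  rw [derivMeasure_singleton (hbv.apply j) ⟨hcx, hxd⟩,
    rightLim_eq_of_tendsto (tendsto_apply (hh.1.tendsto_right hx) j),
    leftLim_eq_of_tendsto (tendsto_apply (hh.1.tendsto_left hx) j), hh.1.2 x hx]
  simp only [Bplus, Bminus, Matrix.add_apply, Matrix.sub_apply, Matrix.smul_apply, smul_eq_mul,
    PiLp.smul_apply, PiLp.add_apply]
  ring

theorem mulVec_eq_zero_of_det_ne_zero {M : Matrix (Fin n) (Fin n) ℂ} (hM : M.det ≠ 0) {y : Cn n}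
    (h : M *ᵥ (fun j => y j) = 0) : y = 0 := by
  have := Matrix.eq_zero_of_mulVec_eq_zero hM h
  ext j
  exact congrFun this j

theorem rightLim_eq_zero_iff (hh : h ∈ S.L0) {x : ℝ} (hx : x ∈ openIvl a b) (hX : x ∉ S.Xi0) :
    Function.rightLim h x = 0 ↔ Function.leftLim h x = 0 := by
  have hdet : (S.Bplus x).det * (S.Bminus x).det ≠ 0 := fun h0 => hX ⟨hx, h0⟩
  have hB := Bplus_mulVec_rightLim hh hx
  have h0 : (fun j => (0 : Cn n) j) = 0 := rfl
  constructor
  · intro h1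
    rw [h1, h0, Matrix.mulVec_zero] at hB
    exact mulVec_eq_zero_of_det_ne_zero (right_ne_zero_of_mul hdet) hB.symm
  · intro h1
    rw [h1, h0, Matrix.mulVec_zero] at hB
    exact mulVec_eq_zero_of_det_ne_zero (left_ne_zero_of_mul hdet) hB

/-- The total mass of `q` on `(c,d)`. -/
def qMass (S : DiffSystem n a b) (c d : ℝ) : ℝ :=
  ∑ i, ∑ j, (derivMeasure (fun x => S.Q x i j) c d).variation.real (Ioo c d)

/-- The equation solved for the derivative, `h' = -J⁻¹ q h`, with crude entrywise bounds. -/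
theorem norm_derivMeasure_le (hh : h ∈ S.L0) {c d : ℝ} (hc : c ∈ openIvl a b)
    (hd : d ∈ openIvl a b) {B : Set ℝ} (hB : MeasurableSet B) (hBcd : B ⊆ Ioo c d) {M : ℝ}
    (hM0 : 0 ≤ M) (hM : ∀ x ∈ Ioo c d, ∀ j, ‖h x j‖ ≤ M) (j : Fin n) :
    ‖derivMeasure (fun x => h x j) c d B‖ ≤
      (∑ i, ∑ j, ‖S.J⁻¹ i j‖) * S.qMass c d * M := by
  have hdet : IsUnit S.J.det := (Matrix.isUnit_iff_isUnit_det _).1 S.J_isUnit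
  have hJ : (fun j => derivMeasure (fun x => h x j) c d B) =
      S.J⁻¹ *ᵥ (fun i => -S.qMul h c d B i) := by
    have : (fun i => -S.qMul h c d B i) =
        S.J *ᵥ (fun j => derivMeasure (fun x => h x j) c d B) := by
      funext i
      have h0 := (mem_L0_iff.1 hh).2.1 c hc d hd B hB hBcd i
      exact (eq_neg_of_add_eq_zero_left h0).symm
    rw [this, Matrix.mulVec_mulVec, Matrix.nonsing_inv_mul _ hdet, Matrix.one_mulVec]
  have hq (i : Fin n) : ‖S.qMul h c d B i‖ ≤ M * S.qMass c d := by
    refine (S.norm_qMul_le (fun x hx => hM x (hBcd hx)) i).trans ?_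
    refine mul_le_mul_of_nonneg_left ?_ hM0
    calc _ ≤ ∑ j, (derivMeasure (fun x => S.Q x i j) c d).variation.real (Ioo c d) :=
          Finset.sum_le_sum fun j _ => measureReal_mono hBcd
      _ ≤ _ := Finset.single_le_sum
          (f := fun i => ∑ j, (derivMeasure (fun x => S.Q x i j) c d).variation.real (Ioo c d))
          (fun i _ => Finset.sum_nonneg fun j _ => measureReal_nonneg) (Finset.mem_univ i)
  have hqM : 0 ≤ M * S.qMass c d := mul_nonneg hM0
    (Finset.sum_nonneg fun i _ => Finset.sum_nonneg fun j _ => measureReal_nonneg)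
  rw [congrFun hJ j]
  simp only [Matrix.mulVec, dotProduct]
  calc _ ≤ ∑ i, ‖S.J⁻¹ j i‖ * (M * S.qMass c d) := by
        refine (norm_sum_le _ _).trans (Finset.sum_le_sum fun i _ => ?_)
        rw [norm_mul, norm_neg]
        exact mul_le_mul_of_nonneg_left (hq i) (norm_nonneg _)
    _ = (∑ i, ‖S.J⁻¹ j i‖) * (M * S.qMass c d) := by rw [Finset.sum_mul]
    _ ≤ (∑ i, ∑ j, ‖S.J⁻¹ i j‖) * (M * S.qMass c d) :=
        mul_le_mul_of_nonneg_right (Finset.single_le_sum (f := fun j => ∑ i, ‖S.J⁻¹ j i‖)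
          (fun i _ => Finset.sum_nonneg fun j _ => norm_nonneg _) (Finset.mem_univ j)) hqM
    _ = _ := by ring

/-- Contraction: a bound `M` for the entries of `h` on `(c,d)` improves to `M / 2`. The hypotheses
`hl` and `hr` express both one-sided limits as increments of `h` up to sign; this encodes a
vanishing limit at either end of the interval, so one statement serves both directions. -/
theorem eq_zero_of_qMass_le (hh : h ∈ S.L0) {c d : ℝ} (hc : c ∈ openIvl a b)
    (hd : d ∈ openIvl a b) (hq : (∑ i, ∑ j, ‖S.J⁻¹ i j‖) * S.qMass c d ≤ 1 / 2)
    (hl : ∀ t ∈ Ioo c d, ∃ B, MeasurableSet B ∧ B ⊆ Ioo c d ∧ ∀ j,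
      ‖Function.leftLim h t j‖ = ‖derivMeasure (fun x => h x j) c d B‖)
    (hr : ∀ t ∈ Ioo c d, ∃ B, MeasurableSet B ∧ B ⊆ Ioo c d ∧ ∀ j,
      ‖Function.rightLim h t j‖ = ‖derivMeasure (fun x => h x j) c d B‖) :
    ∀ t ∈ Ioo c d, h t = 0 := by
  obtain ⟨C, hC⟩ := (hh.1.1.icc hc hd).exists_norm_le
  -- Iterating the halving from the bound `|C|` supplied by bounded variation; the limit `k → ∞`
  -- then gives zero.
  have key : ∀ k : ℕ, ∀ t ∈ Ioo c d, ∀ j, ‖h t j‖ ≤ |C| * (1 / 2) ^ k := by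
    intro k
    induction k with
    | zero =>
      intro t ht j
      rw [pow_zero, mul_one]
      exact (PiLp.norm_apply_le (h t) j).trans
        ((hC t (Ioo_subset_Icc_self ht)).trans (le_abs_self C))
    | succ k ih =>
      have hM0 : 0 ≤ |C| * (1 / 2) ^ k := by positivity
      have bound : ∀ B, MeasurableSet B → B ⊆ Ioo c d → ∀ j,
          ‖derivMeasure (fun x => h x j) c d B‖ ≤ |C| * (1 / 2) ^ (k + 1) := by
        intro B hB hBcd j
        refine (norm_derivMeasure_le hh hc hd hB hBcd hM0 ih j).trans ?_
        calc _ ≤ 1 / 2 * (|C| * (1 / 2) ^ k) := mul_le_mul_of_nonneg_right hq hM0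
          _ = _ := by ring
      intro t ht j
      obtain ⟨B, hB, hBcd, hBl⟩ := hl t ht
      obtain ⟨B', hB', hBcd', hBr⟩ := hr t ht
      have h1 := (hBl j).trans_le (bound B hB hBcd j)
      have h2 := (hBr j).trans_le (bound B' hB' hBcd' j)
      rw [hh.1.2 t (Icc_subset_openIvl hc hd (Ioo_subset_Icc_self ht))]
      simp only [PiLp.smul_apply, PiLp.add_apply, smul_eq_mul, norm_mul]
      have h3 := norm_add_le (Function.rightLim h t j) (Function.leftLim h t j)
      have h4 : ‖(1 / 2 : ℂ)‖ = 1 / 2 := by norm_num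
      rw [h4]
      linarith
  intro t ht
  ext j
  have h1 : Tendsto (fun k : ℕ => |C| * (1 / 2 : ℝ) ^ k) atTop (𝓝 (|C| * 0)) :=
    (tendsto_pow_atTop_nhds_zero_of_lt_one (by norm_num) (by norm_num)).const_mul _
  have h2 := ge_of_tendsto' h1 fun k => key k t ht j
  rw [mul_zero] at h2
  simpa using h2

/-- Compares with the variation of one fixed measure on the larger window, so that continuity from
above can be applied while `(c,d)` shrinks. -/
theorem qMass_le {c d c' d' : ℝ} (hc : c ∈ openIvl a b) (hd : d ∈ openIvl a b)
    (hc' : c' ∈ openIvl a b) (hd' : d' ∈ openIvl a b) (hcc : c' ≤ c) (hdd : d ≤ d') :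
    S.qMass c d ≤
      ∑ i, ∑ j, (derivMeasure (fun x => S.Q x i j) c' d').variation.real (Ioo c d) := by
  refine Finset.sum_le_sum fun i _ => Finset.sum_le_sum fun j _ => ?_
  refine ENNReal.toReal_mono (measure_ne_top _ _)
    (VectorMeasure.variation_apply_le_of_forall_enorm_le measurableSet_Ioo fun E hE hEcd => ?_)
  rw [derivMeasure_congr ((S.Q_bv i j).icc hc hd) ((S.Q_bv i j).icc hc' hd') (x := c) (y := d)
    (fun _ _ => rfl) le_rfl hcc le_rfl hdd hE hEcd]
  exact VectorMeasure.enorm_measure_le_variation _ _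

/-- Continuity from above for finite measures along sets decreasing to `∅`. The threshold `1 / 2` is
the contraction factor. -/
theorem tendsto_sum_variation (μ : Fin n → Fin n → ComplexMeasure ℝ) (K : ℝ) {x : ℝ}
    {s : ℝ → Set ℝ} (hs : ∀ r > x, MeasurableSet (s r)) (hm : ∀ i j, x < i → i ≤ j → s i ⊆ s j)
    (h0 : ⋂ r > x, s r = ∅) :
    ∀ᶠ r in 𝓝[>] x, K * ∑ i, ∑ j, (μ i j).variation.real (s r) ≤ 1 / 2 := by
  have h1 (i j : Fin n) : Tendsto (fun r => (μ i j).variation.real (s r)) (𝓝[>] x) (𝓝 0) := by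
    have := tendsto_measure_biInter_gt (μ := (μ i j).variation) (a := x)
      (fun r hr => (hs r hr).nullMeasurableSet) hm ⟨x + 1, by simp, measure_ne_top _ _⟩
    rw [h0, measure_empty] at this
    have h2 := (ENNReal.tendsto_toReal ENNReal.zero_ne_top).comp this
    rw [ENNReal.toReal_zero] at h2
    exact h2
  have h2 : Tendsto (fun r => K * ∑ i, ∑ j, (μ i j).variation.real (s r)) (𝓝[>] x)
      (𝓝 (K * ∑ _i : Fin n, ∑ _j : Fin n, 0)) :=
    (tendsto_finsetSum _ fun i _ => tendsto_finsetSum _ fun j _ => h1 i j).const_mul K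
  simp only [Finset.sum_const_zero, mul_zero] at h2
  filter_upwards [h2.eventually (gt_mem_nhds (show (0 : ℝ) < 1 / 2 by norm_num))] with r hr
    using hr.le

/-- A solution of the homogeneous equation whose right limit vanishes at `x` vanishes
immediately to the right of `x`. -/
theorem eventually_eq_zero_right (hh : h ∈ S.L0) {x : ℝ} (hx : x ∈ openIvl a b)
    (h0 : Function.rightLim h x = 0) : ∀ᶠ y in 𝓝[>] x, h y = 0 := by
  obtain ⟨d₀, hd₀, hxd₀⟩ := exists_gt_mem_openIvl hx
  -- The intervals `(x,r)` omit `x`, so a possible atom of `q` at `x` does no harm and their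
  -- intersection is empty.
  have hsmall := tendsto_sum_variation (fun i j => derivMeasure (fun x => S.Q x i j) x d₀)
    (∑ i, ∑ j, ‖S.J⁻¹ i j‖) (x := x) (s := fun r => Ioo x r) (fun _ _ => measurableSet_Ioo)
    (fun i j _ hij => Ioo_subset_Ioo_right hij) (by
      ext y
      simp only [mem_iInter, mem_Ioo, mem_empty_iff_false, iff_false, not_forall]
      by_cases hy : x < y
      · exact ⟨y, hy, fun h => lt_irrefl _ h.2⟩
      · exact ⟨x + 1, by simp, fun h => hy h.1⟩)
  obtain ⟨d, hq, hxd, hdd⟩ := (hsmall.and (Ioo_mem_nhdsGT hxd₀)).exists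
  have hd : d ∈ openIvl a b := Icc_subset_openIvl hx hd₀ ⟨hxd.le, hdd.le⟩
  have hbv := hh.1.1.icc hx hd
  have h0j (j : Fin n) : Function.rightLim (fun x => h x j) x = 0 := by
    rw [rightLim_eq_of_tendsto (tendsto_apply (hh.1.tendsto_right hx) j), h0]
    rfl
  have hz := eq_zero_of_qMass_le hh hx hd
    (le_trans (mul_le_mul_of_nonneg_left (qMass_le hx hd hx hd₀ le_rfl hdd.le)
      (Finset.sum_nonneg fun i _ => Finset.sum_nonneg fun j _ => norm_nonneg _)) hq)
    (fun t ht => ⟨Ioo x t, measurableSet_Ioo, Ioo_subset_Ioo_right ht.2.le, fun j => by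
      rw [derivMeasure_Ioo (hbv.apply j) le_rfl ht.1 ht.2.le, h0j, sub_zero,
        leftLim_eq_of_tendsto (tendsto_apply (hh.1.tendsto_left
          (Icc_subset_openIvl hx hd (Ioo_subset_Icc_self ht))) j)]⟩)
    (fun t ht => ⟨Ioc x t, measurableSet_Ioc, fun y hy => ⟨hy.1, hy.2.trans_lt ht.2⟩,
      fun j => by
      rw [derivMeasure_Ioc (hbv.apply j) le_rfl ht.1 ht.2, h0j, sub_zero,
        rightLim_eq_of_tendsto (tendsto_apply (hh.1.tendsto_right
          (Icc_subset_openIvl hx hd (Ioo_subset_Icc_self ht))) j)]⟩)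
  filter_upwards [Ioo_mem_nhdsGT hxd] with y hy using hz y hy

/-- A solution of the homogeneous equation whose left limit vanishes at `x` vanishes
immediately to the left of `x`. -/
theorem eventually_eq_zero_left (hh : h ∈ S.L0) {x : ℝ} (hx : x ∈ openIvl a b)
    (h0 : Function.leftLim h x = 0) : ∀ᶠ y in 𝓝[<] x, h y = 0 := by
  obtain ⟨c₀, hc₀, hcx₀⟩ := exists_lt_mem_openIvl hx
  -- The reflection `r ↦ 2x - r` lets the same limit `r ↓ x` describe intervals shrinking to `x`
  -- from the left.
  have hsmall := tendsto_sum_variation (fun i j => derivMeasure (fun x => S.Q x i j) c₀ x)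
    (∑ i, ∑ j, ‖S.J⁻¹ i j‖) (x := x) (s := fun r => Ioo (2 * x - r) x)
    (fun _ _ => measurableSet_Ioo)
    (fun i j _ hij => Ioo_subset_Ioo_left (by linarith)) (by
      ext y
      simp only [mem_iInter, mem_Ioo, mem_empty_iff_false, iff_false, not_forall]
      by_cases hy : y < x
      · exact ⟨2 * x - y, by simp only [gt_iff_lt]; linarith, fun h => by linarith [h.1]⟩
      · exact ⟨x + 1, by simp, fun h => hy h.2⟩)
  obtain ⟨r, hq, hxr, hrr⟩ :=
    (hsmall.and (Ioo_mem_nhdsGT (show x < 2 * x - c₀ by linarith))).exists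
  set c := 2 * x - r with hcdef
  have hcx : c < x := by linarith
  have hcc : c₀ < c := by linarith
  have hc : c ∈ openIvl a b := Icc_subset_openIvl hc₀ hx ⟨hcc.le, hcx.le⟩
  have hbv := hh.1.1.icc hc hx
  have h0j (j : Fin n) : Function.leftLim (fun x => h x j) x = 0 := by
    rw [leftLim_eq_of_tendsto (tendsto_apply (hh.1.tendsto_left hx) j), h0]
    rfl
  have hz := eq_zero_of_qMass_le hh hc hx
    (le_trans (mul_le_mul_of_nonneg_left (qMass_le hc hx hc₀ hx hcc.le le_rfl)
      (Finset.sum_nonneg fun i _ => Finset.sum_nonneg fun j _ => norm_nonneg _)) hq)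
    (fun t ht => ⟨Ico t x, measurableSet_Ico, fun y hy => ⟨ht.1.trans_le hy.1, hy.2⟩,
      fun j => by
      rw [derivMeasure_Ico (hbv.apply j) ht.1 ht.2 le_rfl, h0j, zero_sub, norm_neg,
        leftLim_eq_of_tendsto (tendsto_apply (hh.1.tendsto_left
          (Icc_subset_openIvl hc hx (Ioo_subset_Icc_self ht))) j)]⟩)
    (fun t ht => ⟨Ioo t x, measurableSet_Ioo, Ioo_subset_Ioo_left ht.1.le,
      fun j => by
      rw [derivMeasure_Ioo (hbv.apply j) ht.1.le ht.2 le_rfl, h0j, zero_sub, norm_neg,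
        rightLim_eq_of_tendsto (tendsto_apply (hh.1.tendsto_right
          (Icc_subset_openIvl hc hx (Ioo_subset_Icc_self ht))) j)]⟩)
  filter_upwards [Ioo_mem_nhdsLT hcx] with y hy using hz y hy

theorem eq_zero_of_limits (hh : BalancedBV a b h) {x : ℝ} (hx : x ∈ openIvl a b)
    (h1 : Function.rightLim h x = 0) (h2 : Function.leftLim h x = 0) : h x = 0 := by
  rw [hh.2 x hx, h1, h2, add_zero, smul_zero]

/-- Unique continuation on intervals without points of `Ξ₀`. -/
theorem eqOn_zero_of_eventually (hh : h ∈ S.L0) {p r x₀ : ℝ} (hsub : Ioo p r ⊆ openIvl a b)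
    (hX : ∀ x ∈ Ioo p r, x ∉ S.Xi0) (hx₀ : x₀ ∈ Ioo p r) (h0 : ∀ᶠ y in 𝓝 x₀, h y = 0) :
    ∀ x ∈ Ioo p r, h x = 0 := by
  -- The set where `h` vanishes locally is open; by connectedness it suffices that it is relatively
  -- closed. At a limit point outside it both one-sided limits would be nonzero, so `h` would not
  -- vanish at nearby points on either side.
  have hss : Ioo p r ⊆ {x | ∀ᶠ y in 𝓝 x, h y = 0} := by
    refine isPreconnected_Ioo.subset_of_closure_inter_subset isOpen_setOfPred_eventually_nhds
      ⟨x₀, hx₀, h0⟩ ?_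
    rintro x ⟨hxc, hxs⟩
    have hx := hsub hxs
    by_contra hxn
    have hr : Function.rightLim h x ≠ 0 := by
      intro hr
      have hl := (rightLim_eq_zero_iff hh hx (hX x hxs)).1 hr
      refine hxn ?_
      rw [mem_ofPred_eq, ← nhdsNE_sup_pure, ← nhdsLT_sup_nhdsGT, eventually_sup, eventually_sup]
      exact ⟨⟨eventually_eq_zero_left hh hx hl, eventually_eq_zero_right hh hx hr⟩,
        eq_zero_of_limits hh.1 hx hr hl⟩
    have hl : Function.leftLim h x ≠ 0 := fun hl =>
      hr ((rightLim_eq_zero_iff hh hx (hX x hxs)).2 hl)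
    have hne : ∀ᶠ y in 𝓝 x, y ∉ {x | ∀ᶠ y in 𝓝 x, h y = 0} := by
      rw [← nhdsNE_sup_pure, ← nhdsLT_sup_nhdsGT, eventually_sup, eventually_sup]
      refine ⟨⟨?_, ?_⟩, hxn⟩
      · filter_upwards [(hh.1.tendsto_left hx).eventually_ne hl] with y hy hy'
          using hy hy'.self_of_nhds
      · filter_upwards [(hh.1.tendsto_right hx).eventually_ne hr] with y hy hy'
          using hy hy'.self_of_nhds
    exact (mem_closure_iff_frequently.1 hxc) hne
  exact fun x hx => (hss hx).self_of_nhds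

theorem eqOn_zero_of_rightLim (hh : h ∈ S.L0) {p r : ℝ} (hp : p ∈ openIvl a b)
    (hr : r ∈ openIvl a b) (hX : ∀ x ∈ Ioo p r, x ∉ S.Xi0) (h0 : Function.rightLim h p = 0) :
    ∀ x ∈ Ioo p r, h x = 0 := by
  rcases le_or_gt r p with hpr | hpr
  · simp [Ioo_eq_empty (not_lt.2 hpr)]
  obtain ⟨s, hs, hs0⟩ := mem_nhdsGT_iff_exists_Ioo_subset.1 (eventually_eq_zero_right hh hp h0)
  obtain ⟨x₀, hpx, hx⟩ := exists_between (lt_min hs hpr)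
  refine eqOn_zero_of_eventually hh
    (Ioo_subset_Icc_self.trans (Icc_subset_openIvl hp hr)) hX
    ⟨hpx, hx.trans_le (min_le_right _ _)⟩ ?_
  filter_upwards [Ioo_mem_nhds hpx (hx.trans_le (min_le_left _ _))] with y hy using hs0 hy

theorem eqOn_zero_of_leftLim (hh : h ∈ S.L0) {p r : ℝ} (hp : p ∈ openIvl a b)
    (hr : r ∈ openIvl a b) (hX : ∀ x ∈ Ioo p r, x ∉ S.Xi0) (h0 : Function.leftLim h r = 0) :
    ∀ x ∈ Ioo p r, h x = 0 := by
  rcases le_or_gt r p with hpr | hpr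
  · simp [Ioo_eq_empty (not_lt.2 hpr)]
  obtain ⟨s, hs, hs0⟩ := mem_nhdsLT_iff_exists_Ioo_subset.1 (eventually_eq_zero_left hh hr h0)
  obtain ⟨x₀, hpx, hx⟩ := exists_between (max_lt hs hpr)
  refine eqOn_zero_of_eventually hh
    (Ioo_subset_Icc_self.trans (Icc_subset_openIvl hp hr)) hX
    ⟨(le_max_right _ _).trans_lt hpx, hx⟩ ?_
  filter_upwards [Ioo_mem_nhds ((le_max_left _ _).trans_lt hpx) hx] with y hy using hs0 hy

end DiffSystem

/-! ### Correcting a function to meet the conditions -/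

theorem exists_sub_orthogonal {n : ℕ} {N : Set (Cn n)} (h0 : 0 ∈ N)
    (hN : ∀ y ∈ N, ∀ y' ∈ N, ∀ z : ℂ, y + z • y' ∈ N) (e : Cn n) :
    ∃ y ∈ N, ∀ y' ∈ N, inner ℂ y' (e - y) = 0 := by
  let K : Submodule ℂ (Cn n) :=
    { carrier := N
      add_mem' := fun {y y'} hy hy' => by simpa using hN y hy y' hy' 1
      zero_mem' := h0
      smul_mem' := fun z y hy => by simpa using hN 0 h0 y hy z }
  exact ⟨K.starProjection e, K.starProjection_apply_mem e,
    (K.mem_orthogonal _).1 (K.sub_starProjection_mem_orthogonal e)⟩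

theorem Side.eval_congr {n : ℕ} (s : Side) {u v : ℝ → Cn n} {x : ℝ} (h : u =ᶠ[𝓝 x] v) :
    s.eval u x = s.eval v x := by
  cases s
  · exact leftLim_congr_nhds h
  · exact h.self_of_nhds
  · exact rightLim_congr_nhds h

theorem Side.eval_add_smul {n : ℕ} {a b : EReal} (s : Side) {u v : ℝ → Cn n} {x : ℝ}
    (hu : BalancedBV a b u) (hv : BalancedBV a b v) (z : ℂ) (hx : x ∈ openIvl a b) :
    s.eval (fun x => u x + z • v x) x = s.eval u x + z • s.eval v x := by
  cases s
  · exact hu.leftLim_add_smul hv z hx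
  · rfl
  · exact hu.rightLim_add_smul hv z hx

namespace DiffSystem

variable {n : ℕ} {a b : EReal} {S : DiffSystem n a b} {u v h : ℝ → Cn n} {τ : ℤ → ℝ} {s : Side}
  {k : ℤ}

theorem Cond.congr (hv : S.Cond s τ k u) (huv : u =ᶠ[𝓝 (τ k)] v) : S.Cond s τ k v := by
  intro y hy
  rw [← Side.eval_congr _ huv]
  exact hv y hy

theorem Cond.add_smul (hτ : S.Admissible τ) (hu : BalancedBV a b u) (hv : BalancedBV a b v)
    (hcu : S.Cond s τ k u) (hcv : S.Cond s τ k v) (z : ℂ) :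
    S.Cond s τ k (fun x => u x + z • v x) := by
  intro y hy
  rw [Side.eval_add_smul _ hu hv z (hτ.mem k), inner_add_right, inner_smul_right, hcu y hy,
    hcv y hy, mul_zero, add_zero]

/-- The elements of `𝓛₀` are continuous at `τ_0`. -/
theorem rightLim_eq_leftLim_zero (hτ : S.Admissible τ) (hh : h ∈ S.L0) :
    Function.rightLim h (τ 0) = Function.leftLim h (τ 0) := by
  have hB := Bplus_mulVec_rightLim hh (hτ.mem 0)
  rw [hτ.Bplus_zero, hτ.Bminus_zero] at hB
  have hdet : S.J.det ≠ 0 := ((Matrix.isUnit_iff_isUnit_det _).1 S.J_isUnit).ne_zero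
  refine sub_eq_zero.1 (mulVec_eq_zero_of_det_ne_zero hdet ?_)
  have : (fun j => (Function.rightLim h (τ 0) - Function.leftLim h (τ 0)) j) =
    (fun j => Function.rightLim h (τ 0) j) - (fun j => Function.leftLim h (τ 0) j) := rfl
  rw [this, Matrix.mulVec_sub, hB, sub_self]

/-- Elements of `𝓛₀` are continuous at `τ_0`, so the choice of side in condition `(0)` does not
matter for them; this makes all three versions work alike. -/
theorem eval_zero (hτ : S.Admissible τ) (hh : h ∈ S.L0) (s : Side) :
    s.eval h (τ 0) = h (τ 0) := by
  have h1 := rightLim_eq_leftLim_zero hτ hh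
  have h2 := hh.1.2 (τ 0) (hτ.mem 0)
  have h3 : h (τ 0) = Function.leftLim h (τ 0) := by
    rw [h2, h1]
    module
  cases s
  · exact h3.symm
  · rfl
  · exact h1.trans h3.symm

theorem rightLim_zero_fun {x : ℝ} : Function.rightLim (fun _ : ℝ => (0 : Cn n)) x = 0 :=
  rightLim_eq_of_tendsto tendsto_const_nhds

theorem leftLim_zero_fun {x : ℝ} : Function.leftLim (fun _ : ℝ => (0 : Cn n)) x = 0 :=
  leftLim_eq_of_tendsto tendsto_const_nhds

/-- A function can be made to satisfy condition `(k)`, for `k > 0`, by subtracting an element of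
`𝓛₀` which is supported on `[τ_k,b)`. -/
theorem exists_cond_pos (hτ : S.Admissible τ) (hu : BalancedBV a b u) (hk : 0 < k) :
    ∃ h ∈ S.L0, (∀ x ∈ openIvl a b, x < τ k → h x = 0) ∧
      S.Cond s τ k (fun x => u x + (-1 : ℂ) • h x) := by
  have hN : S.N τ k = {y | ∃ h ∈ S.L0, (∀ x ∈ openIvl a b, x < τ k → h x = 0) ∧
      y = Function.rightLim h (τ k)} := if_pos hk
  obtain ⟨y, hy, horth⟩ := exists_sub_orthogonal (N := S.N τ k)
    (by rw [hN]; exact ⟨_, zero_mem_L0, fun _ _ _ => rfl, rightLim_zero_fun.symm⟩)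
    (by
      rw [hN]
      rintro _ ⟨h, hh, h0, rfl⟩ _ ⟨h', hh', h0', rfl⟩ z
      refine ⟨_, add_smul_mem_L0 hh hh' z, fun x hx hxk => ?_,
        (hh.1.rightLim_add_smul hh'.1 z (hτ.mem k)).symm⟩
      simp only [h0 x hx hxk, h0' x hx hxk, smul_zero, add_zero])
    (Function.rightLim u (τ k))
  have hy' := hy
  rw [hN] at hy'
  obtain ⟨h, hh, h0, rfl⟩ := hy'
  refine ⟨h, hh, h0, fun y' hy' => ?_⟩
  rw [if_pos hk, Side.eval_add_smul _ hu hh.1 _ (hτ.mem k), neg_one_smul, ← sub_eq_add_neg]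
  exact horth y' hy'

/-- A function can be made to satisfy condition `(k)`, for `k < 0`, by subtracting an element of
`𝓛₀` which is supported on `(a,τ_k]`. -/
theorem exists_cond_neg (hτ : S.Admissible τ) (hu : BalancedBV a b u) (hk : k < 0) :
    ∃ h ∈ S.L0, (∀ x ∈ openIvl a b, τ k < x → h x = 0) ∧
      S.Cond s τ k (fun x => u x + (-1 : ℂ) • h x) := by
  have hk' : ¬ 0 < k := not_lt.2 hk.le
  have hN : S.N τ k = {y | ∃ h ∈ S.L0, (∀ x ∈ openIvl a b, τ k < x → h x = 0) ∧
      y = Function.leftLim h (τ k)} := (if_neg hk').trans (if_pos hk)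
  obtain ⟨y, hy, horth⟩ := exists_sub_orthogonal (N := S.N τ k)
    (by rw [hN]; exact ⟨_, zero_mem_L0, fun _ _ _ => rfl, leftLim_zero_fun.symm⟩)
    (by
      rw [hN]
      rintro _ ⟨h, hh, h0, rfl⟩ _ ⟨h', hh', h0', rfl⟩ z
      refine ⟨_, add_smul_mem_L0 hh hh' z, fun x hx hxk => ?_,
        (hh.1.leftLim_add_smul hh'.1 z (hτ.mem k)).symm⟩
      simp only [h0 x hx hxk, h0' x hx hxk, smul_zero, add_zero])
    (Function.leftLim u (τ k))
  have hy' := hy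
  rw [hN] at hy'
  obtain ⟨h, hh, h0, rfl⟩ := hy'
  refine ⟨h, hh, h0, fun y' hy' => ?_⟩
  rw [if_neg hk', if_pos hk, Side.eval_add_smul _ hu hh.1 _ (hτ.mem k), neg_one_smul,
    ← sub_eq_add_neg]
  exact horth y' hy'

theorem N_zero : S.N τ 0 = {y | ∃ h ∈ S.L0, y = h (τ 0)} :=
  (if_neg (lt_irrefl _)).trans (if_neg (lt_irrefl _))

/-- A function can be made to satisfy condition `(0)` by subtracting an element of `𝓛₀`. -/
theorem exists_cond_zero (hτ : S.Admissible τ) (hu : BalancedBV a b u) (s : Side) :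
    ∃ h ∈ S.L0, S.Cond s τ 0 (fun x => u x + (-1 : ℂ) • h x) := by
  obtain ⟨y, hy, horth⟩ := exists_sub_orthogonal (N := S.N τ 0)
    (by rw [N_zero]; exact ⟨_, zero_mem_L0, rfl⟩)
    (by
      rw [N_zero]
      rintro _ ⟨h, hh, rfl⟩ _ ⟨h', hh', rfl⟩ z
      exact ⟨_, add_smul_mem_L0 hh hh' z, rfl⟩)
    (s.eval u (τ 0))
  have hy' := hy
  rw [N_zero] at hy'
  obtain ⟨h, hh, rfl⟩ := hy'
  refine ⟨h, hh, fun y' hy' => ?_⟩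
  rw [if_neg (lt_irrefl _), if_neg (lt_irrefl _), Side.eval_add_smul _ hu hh.1 _ (hτ.mem 0),
    neg_one_smul, ← sub_eq_add_neg, eval_zero hτ hh]
  exact horth y' hy'

theorem Admissible.exists_nat (hτ : S.Admissible τ) {c d : ℝ} (hc : c ∈ openIvl a b)
    (hd : d ∈ openIvl a b) : ∃ k : ℕ, τ (-(k + 1)) < c ∧ d < τ (k + 1) := by
  obtain ⟨p, hp⟩ := eventually_atTop.1 (hτ.tendsto_right.eventually (lt_mem_nhds hd.2))
  obtain ⟨m, hm⟩ := eventually_atBot.1 (hτ.tendsto_left.eventually (gt_mem_nhds hc.1))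
  refine ⟨p.toNat + (-m).toNat, ?_, ?_⟩
  · exact EReal.coe_lt_coe_iff.1 (hm _ (by push_cast; omega))
  · exact EReal.coe_lt_coe_iff.1 (hp _ (by push_cast; omega))

/-- The inductive step in the construction of the solution satisfying all conditions. -/
theorem exists_cond_succ (hτ : S.Admissible τ) (hu : BalancedBV a b u) (k : ℕ) {g : ℝ → Cn n}
    (hg : g ∈ S.L0)
    (hcond : ∀ j : ℤ, j.natAbs ≤ k → S.Cond s τ j (fun x => u x + (-1 : ℂ) • g x)) :
    ∃ g' ∈ S.L0,
      (∀ j : ℤ, j.natAbs ≤ k + 1 → S.Cond s τ j (fun x => u x + (-1 : ℂ) • g' x)) ∧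
      ∀ x ∈ Ioo (τ (-(k + 1))) (τ (k + 1)), g' x = g x := by
  have hv := hu.add_smul hg.1 (-1)
  obtain ⟨p, hp, hp0, hpc⟩ := exists_cond_pos (s := s) (k := k + 1) hτ hv (by omega)
  obtain ⟨m, hm, hm0, hmc⟩ := exists_cond_neg (s := s) (k := -(k + 1)) hτ hv (by omega)
  have hlt : τ (-(k + 1)) < τ (k + 1) := hτ.strictMono (by omega)
  have hsub : Ioo (τ (-(k + 1))) (τ (k + 1)) ⊆ openIvl a b :=
    Ioo_subset_Icc_self.trans (Icc_subset_openIvl (hτ.mem _) (hτ.mem _))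
  refine ⟨_, add_smul_mem_L0 (add_smul_mem_L0 hg hp 1) hm 1, fun j hj => ?_, fun x hx => ?_⟩
  · rcases Nat.lt_or_eq_of_le hj with hj' | hj'
    -- Both new corrections vanish near the inner points `τ j`, so the earlier conditions are
    -- unaffected.
    · refine (hcond j (Nat.lt_succ_iff.1 hj')).congr ?_
      filter_upwards [Ioo_mem_nhds (hτ.strictMono (show -(k + 1 : ℤ) < j by omega))
        (hτ.strictMono (show j < (k + 1 : ℤ) by omega))] with x hx
      simp only [hp0 x (hsub hx) hx.2, hm0 x (hsub hx) hx.1, smul_zero, add_zero]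
    · rcases Int.natAbs_eq j with hjk | hjk
      · obtain rfl : j = k + 1 := by omega
        refine hpc.congr ?_
        filter_upwards [Ioi_mem_nhds hlt, isOpen_openIvl.mem_nhds (hτ.mem (k + 1))] with x hx hx'
        simp only [hm0 x hx' hx, smul_zero, add_zero]
        module
      · obtain rfl : j = -(k + 1) := by omega
        refine hmc.congr ?_
        filter_upwards [Iio_mem_nhds hlt, isOpen_openIvl.mem_nhds (hτ.mem (-(k + 1)))]
          with x hx hx'
        simp only [hp0 x hx' hx, smul_zero, add_zero]
        module
  · simp only [hp0 x (hsub hx) hx.2, hm0 x (hsub hx) hx.1, smul_zero, add_zero]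

/-- A balanced function can be made to satisfy all conditions by subtracting an element of
`𝓛₀`. -/
theorem exists_forall_cond (hτ : S.Admissible τ) (hu : BalancedBV a b u) (s : Side) :
    ∃ h ∈ S.L0, ∀ k, S.Cond s τ k (fun x => u x + (-1 : ℂ) • h x) := by
  let P (k : ℕ) (g : ℝ → Cn n) : Prop :=
    g ∈ S.L0 ∧ ∀ j : ℤ, j.natAbs ≤ k → S.Cond s τ j (fun x => u x + (-1 : ℂ) • g x)
  have step : ∀ (k : ℕ) (g : {g // P k g}), ∃ g' : {g // P (k + 1) g},
      ∀ x ∈ Ioo (τ (-(k + 1))) (τ (k + 1)), g'.1 x = g.1 x := fun k g => by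
    obtain ⟨g', h1, h2, h3⟩ := exists_cond_succ hτ hu k g.2.1 g.2.2
    exact ⟨⟨g', h1, h2⟩, h3⟩
  choose F hF using step
  obtain ⟨g₀, hg₀, hc₀⟩ := exists_cond_zero hτ hu s
  have hP0 : P 0 g₀ := ⟨hg₀, fun j hj => by
    obtain rfl : j = 0 := by omega
    exact hc₀⟩
  -- Stage `k` carries its conditions along, and `hG` shows that later stages never alter it on
  -- `(τ_{-(k+1)}, τ_{k+1})`.
  let G : ∀ k : ℕ, {g // P k g} := fun k => Nat.rec ⟨g₀, hP0⟩ F k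
  have hG : ∀ k l : ℕ, k ≤ l → ∀ x ∈ Ioo (τ (-(k + 1))) (τ (k + 1)),
      (G l).1 x = (G k).1 x := by
    intro k l hkl x hx
    induction l, hkl using Nat.le_induction with
    | base => rfl
    | succ l hkl ih =>
      refine Eq.trans (hF l (G l) x ⟨?_, ?_⟩) ih
      · exact (hτ.strictMono.monotone (by omega)).trans_lt hx.1
      · exact hx.2.trans_le (hτ.strictMono.monotone (by omega))
  -- A stage that is already final at `x`; outside `(a,b)` the value `0` is arbitrary.
  have hK : ∀ x : ℝ, ∃ k : ℕ, x ∈ openIvl a b → x ∈ Ioo (τ (-(k + 1))) (τ (k + 1)) := fun x => by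
    by_cases hx : x ∈ openIvl a b
    · obtain ⟨k, h1, h2⟩ := hτ.exists_nat hx hx
      exact ⟨k, fun _ => ⟨h1, h2⟩⟩
    · exact ⟨0, fun h => absurd h hx⟩
  choose K hK using hK
  have hH : ∀ k : ℕ, ∀ x ∈ Ioo (τ (-(k + 1))) (τ (k + 1)), (G (K x)).1 x = (G k).1 x := by
    intro k x hx
    have hx' := hK x (Icc_subset_openIvl (hτ.mem _) (hτ.mem _) (Ioo_subset_Icc_self hx))
    rcases le_total k (K x) with hkK | hkK
    · exact hG _ _ hkK x hx
    · exact (hG _ _ hkK x hx').symm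
  refine ⟨fun x => (G (K x)).1 x, mem_L0_of_forall_exists fun c hc d hd => ?_, fun j => ?_⟩
  · obtain ⟨k, h1, h2⟩ := hτ.exists_nat hc hd
    exact ⟨(G k).1, (G k).2.1, fun x hx => hH k x ⟨h1.trans_le hx.1, hx.2.trans_lt h2⟩⟩
  · refine ((G j.natAbs).2.2 j le_rfl).congr ?_
    filter_upwards [Ioo_mem_nhds
      (hτ.strictMono (show -((j.natAbs : ℤ) + 1) < j by omega))
      (hτ.strictMono (show j < ((j.natAbs : ℤ) + 1) by omega))] with x hx
    rw [hH _ x hx]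

/-! ### Vanishing of elements of `𝓛₀` that meet the conditions -/

theorem Admissible.notMem_Xi0 (hτ : S.Admissible τ) (k : ℤ) {x : ℝ}
    (hx : x ∈ Ioo (τ k) (τ (k + 1))) : x ∉ S.Xi0 := by
  intro hX
  obtain ⟨j, rfl⟩ := hτ.Xi0_subset hX
  have h1 := hτ.strictMono.lt_iff_lt.1 hx.1
  have h2 := hτ.strictMono.lt_iff_lt.1 hx.2
  omega

theorem Cond.zero_of_mem_L0 (hτ : S.Admissible τ) (hh : h ∈ S.L0) (hc : S.Cond s τ 0 h) :
    h (τ 0) = 0 := by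
  have := hc (h (τ 0)) (by rw [N_zero]; exact ⟨h, hh, rfl⟩)
  rw [eval_zero hτ hh] at this
  exact inner_self_eq_zero.1 this

/-- An element of `𝓛₀` which vanishes on `[τ_0,τ_k)` and satisfies condition `(k)`, for `k > 0`,
vanishes on `[τ_0,τ_{k+1})`. -/
theorem eq_zero_step_right (hτ : S.Admissible τ) (hh : h ∈ S.L0) (hk : 0 < k)
    (hc : S.Cond s τ k h) (h0 : ∀ x ∈ Ico (τ 0) (τ k), h x = 0) :
    ∀ x ∈ Ico (τ 0) (τ (k + 1)), h x = 0 := by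
  have h0k : τ 0 < τ k := hτ.strictMono hk
  have hl : Function.leftLim h (τ k) = 0 := by
    refine leftLim_eq_of_tendsto (tendsto_const_nhds.congr' ?_)
    filter_upwards [Ioo_mem_nhdsLT h0k] with x hx
    exact (h0 x ⟨hx.1.le, hx.2⟩).symm
  -- Since `h` already vanishes on `[τ_0, τ_k)`, erasing it to the left of `τ_k` is a gluing with
  -- zero along `(τ_0, τ_k)`. The result is a witness for `h⁺(τ_k) ∈ N_k`, which condition `(k)`
  -- makes orthogonal to itself.
  have hcut : (fun x => if x < τ k then 0 else h x) ∈ S.L0 := by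
    refine mem_L0_of_glue (hτ.mem 0) (hτ.mem k) h0k zero_mem_L0 hh
      (fun x _ hx => if_pos hx) fun x _ hx => ?_
    split_ifs with hxk
    · exact (h0 x ⟨hx.le, hxk⟩).symm
    · rfl
  have hcutr : Function.rightLim (fun x => if x < τ k then 0 else h x) (τ k) =
      Function.rightLim h (τ k) := by
    refine rightLim_eq_of_tendsto ((hh.1.tendsto_right (hτ.mem k)).congr' ?_)
    filter_upwards [self_mem_nhdsWithin] with x hx
    rw [if_neg (not_lt.2 (le_of_lt hx))]
  have hmem : Function.rightLim h (τ k) ∈ S.N τ k := by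
    rw [N, if_pos hk]
    exact ⟨_, hcut, fun x _ hx => if_pos hx, hcutr.symm⟩
  have hr : Function.rightLim h (τ k) = 0 := by
    have := hc _ hmem
    rw [if_pos hk] at this
    exact inner_self_eq_zero.1 this
  have hright := eqOn_zero_of_rightLim hh (hτ.mem k) (hτ.mem (k + 1))
    (fun x hx => hτ.notMem_Xi0 k hx) hr
  intro x hx
  rcases lt_trichotomy x (τ k) with hxk | rfl | hxk
  · exact h0 x ⟨hx.1, hxk⟩
  · exact eq_zero_of_limits hh.1 (hτ.mem k) hr hl
  · exact hright x ⟨hxk, hx.2⟩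

/-- An element of `𝓛₀` which vanishes on `(τ_k,τ_0]` and satisfies condition `(k)`, for `k < 0`,
vanishes on `(τ_{k-1},τ_0]`. -/
theorem eq_zero_step_left (hτ : S.Admissible τ) (hh : h ∈ S.L0) (hk : k < 0)
    (hc : S.Cond s τ k h) (h0 : ∀ x ∈ Ioc (τ k) (τ 0), h x = 0) :
    ∀ x ∈ Ioc (τ (k - 1)) (τ 0), h x = 0 := by
  have hk' : ¬ 0 < k := not_lt.2 hk.le
  have h0k : τ k < τ 0 := hτ.strictMono hk
  have hr : Function.rightLim h (τ k) = 0 := by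
    refine rightLim_eq_of_tendsto (tendsto_const_nhds.congr' ?_)
    filter_upwards [Ioo_mem_nhdsGT h0k] with x hx
    exact (h0 x ⟨hx.1, hx.2.le⟩).symm
  have hcut : (fun x => if τ k < x then 0 else h x) ∈ S.L0 := by
    refine mem_L0_of_glue (hτ.mem k) (hτ.mem 0) h0k hh zero_mem_L0 (fun x _ hx => ?_)
      fun x _ hx => if_pos hx
    split_ifs with hxk
    · exact (h0 x ⟨hxk, hx.le⟩).symm
    · rfl
  have hcutl : Function.leftLim (fun x => if τ k < x then 0 else h x) (τ k) =
      Function.leftLim h (τ k) := by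
    refine leftLim_eq_of_tendsto ((hh.1.tendsto_left (hτ.mem k)).congr' ?_)
    filter_upwards [self_mem_nhdsWithin] with x hx
    rw [if_neg (not_lt.2 (le_of_lt hx))]
  have hmem : Function.leftLim h (τ k) ∈ S.N τ k := by
    rw [N, if_neg hk', if_pos hk]
    exact ⟨_, hcut, fun x _ hx => if_pos hx, hcutl.symm⟩
  have hl : Function.leftLim h (τ k) = 0 := by
    have := hc _ hmem
    rw [if_neg hk', if_pos hk] at this
    exact inner_self_eq_zero.1 this
  have hleft := eqOn_zero_of_leftLim hh (hτ.mem (k - 1)) (hτ.mem k)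
    (fun x hx => hτ.notMem_Xi0 (k - 1) (by rwa [sub_add_cancel])) hl
  intro x hx
  rcases lt_trichotomy x (τ k) with hxk | rfl | hxk
  · exact hleft x ⟨hx.1, hxk⟩
  · exact eq_zero_of_limits hh.1 (hτ.mem k) hr hl
  · exact h0 x ⟨hxk, hx.2⟩

/-- An element of `𝓛₀` which satisfies all conditions vanishes. -/
theorem eqOn_zero_of_forall_cond (hτ : S.Admissible τ) (hh : h ∈ S.L0)
    (hc : ∀ k, S.Cond s τ k h) : ∀ x ∈ openIvl a b, h x = 0 := by
  have h0 : h (τ 0) = 0 := (hc 0).zero_of_mem_L0 hτ hh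
  have hright : ∀ k : ℕ, ∀ x ∈ Ico (τ 0) (τ (k + 1)), h x = 0 := by
    intro k
    induction k with
    | zero =>
      -- Continuity at `τ_0` turns `h(τ_0) = 0` into a vanishing right limit.
      have := eqOn_zero_of_rightLim hh (hτ.mem 0) (hτ.mem (0 + 1))
        (fun x hx => hτ.notMem_Xi0 0 hx) ((eval_zero hτ hh Side.plus).trans h0)
      intro x hx
      rcases hx.1.eq_or_lt with rfl | hx0
      · exact h0
      · exact this x ⟨hx0, hx.2⟩
    | succ k ih =>
      push_cast
      exact eq_zero_step_right hτ hh (by omega) (hc (k + 1)) ih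
  have hleft : ∀ k : ℕ, ∀ x ∈ Ioc (τ (-(k + 1))) (τ 0), h x = 0 := by
    intro k
    induction k with
    | zero =>
      have := eqOn_zero_of_leftLim hh (hτ.mem (-1)) (hτ.mem 0)
        (fun x hx => hτ.notMem_Xi0 (-1) hx) ((eval_zero hτ hh Side.minus).trans h0)
      intro x hx
      rcases hx.2.eq_or_lt with rfl | hx0
      · exact h0
      · exact this x ⟨by simpa using hx.1, hx0⟩
    | succ k ih =>
      have := eq_zero_step_left hτ hh (by omega) (hc (-(k + 1))) ih
      rwa [show -(((k + 1 : ℕ) : ℤ) + 1) = -((k : ℤ) + 1) - 1 by push_cast; ring]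
  intro x hx
  obtain ⟨k, h1, h2⟩ := hτ.exists_nat hx hx
  rcases le_total (τ 0) x with hx0 | hx0
  · exact hright k x ⟨hx0, h2⟩
  · exact hleft k x ⟨h1, hx0⟩

/-! ### Classes -/

theorem WMeas.sub {f g : ℝ → Cn n} (hf : S.WMeas f) (hg : S.WMeas g) :
    S.WMeas (fun x => f x - g x) :=
  fun c hc d hd => (hf c hc d hd).sub (hg c hc d hd)

theorem mem_cls_self (hu : S.MemL2 u) : u ∈ S.cls u := by
  refine ⟨hu, ?_⟩
  simp only [sub_self]
  exact (zero_mem_L0 (S := S)).2.2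

theorem null_of_mem_cls (hu : S.MemL2 u) (hv : v ∈ S.cls u) :
    S.Null (fun x => v x - u x) :=
  null_of_normSq_eq_zero (WMeas.sub hv.1.1 hu.1) hv.2

end DiffSystem

end

/-! ### The distinguished representative -/

open DiffSystem in
theorem lemmaL {n : ℕ} {a b : EReal} (hab : a < b) (S : DiffSystem n a b)
    (τ : ℤ → ℝ) (hτ : S.Admissible τ) (s : Side)
    (u f : ℝ → Cn n) (hu : S.MemL2 u) (hf : S.MemL2 f)
    (huf : (S.cls u, S.cls f) ∈ S.Tmax) :
    ∃ v : ℝ → Cn n,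
      (v ∈ S.cls u ∧ BalancedBV a b v ∧ (v, f) ∈ S.calTmax ∧ ∀ k : ℤ, S.Cond s τ k v) ∧
      ∀ v' : ℝ → Cn n,
        (v' ∈ S.cls u ∧ BalancedBV a b v' ∧ (v', f) ∈ S.calTmax ∧ ∀ k : ℤ, S.Cond s τ k v') →
          EqOn v' v (openIvl a b) := by
  obtain ⟨u₀, f₀, ⟨hu₀, hf₀, hbal, hsol⟩, heq⟩ := huf
  obtain ⟨hclsu, hclsf⟩ := Prod.mk.inj heq
  -- Membership in `T_max` supplies a pair solving with some `f₀` in the class of `f`; since `w f =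
  -- w f₀`, the given `f` works as well.
  have hsolf : S.Solves u₀ f := by
    have hnull := null_of_mem_cls hf₀ (hclsf ▸ mem_cls_self hf : f ∈ S.cls f₀)
    intro c hc d hd B hB hBcd i
    rw [hnull.wMul_eq hc hd]
    exact hsol c hc d hd B hB hBcd i
  have hnull₀ := null_of_mem_cls hu (hclsu ▸ mem_cls_self hu₀ : u₀ ∈ S.cls u)
  obtain ⟨h, hh, hcond⟩ := exists_forall_cond hτ hbal s
  have hhnull := (mem_L0_iff.1 hh).2.2
  have hv : BalancedBV a b (fun x => u₀ x + (-1 : ℂ) • h x) := hbal.add_smul hh.1 (-1)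
  have hvsol : S.Solves (fun x => u₀ x + (-1 : ℂ) • h x) f := hsolf.add_smul_L0 hbal hh (-1)
  have hneg : S.Null (fun x => (-1 : ℂ) • h x) := by
    simpa using ((mem_L0_iff.1 (zero_mem_L0 (S := S))).2.2).add_smul hhnull (-1)
  have hvL2 : S.MemL2 (fun x => u₀ x + (-1 : ℂ) • h x) :=
    ⟨WMeas.of_bv hv.1, by rw [hneg.normSq_add_eq]; exact hu₀.2⟩
  have hvcls : (fun x => u₀ x + (-1 : ℂ) • h x) ∈ S.cls u := by
    refine ⟨hvL2, ?_⟩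
    have : (fun x => u₀ x + (-1 : ℂ) • h x - u x) =
        fun x => (u₀ x - u x) + (-1 : ℂ) • h x := by
      funext x; abel
    rw [this]
    exact (hnull₀.add_smul hhnull (-1)).normSq_eq_zero
  refine ⟨_, ⟨hvcls, hv, ⟨hvL2, hf, hv, hvsol⟩, hcond⟩, ?_⟩
  rintro v' ⟨hv'cls, hv'bal, ⟨_, _, _, hv'sol⟩, hv'cond⟩ x hx
  have hnull : S.Null (fun x => v' x - (u₀ x + (-1 : ℂ) • h x)) := by
    simpa using (null_of_mem_cls hu hv'cls).sub (null_of_mem_cls hu hvcls)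
  have hmem := sub_mem_L0 hv'bal hv hv'sol hvsol hnull
  have hdiff := eqOn_zero_of_forall_cond hτ hmem (s := s) (fun k => by
    have := (hv'cond k).add_smul hτ hv'bal hv (hcond k) (-1)
    simpa only [neg_one_smul, ← sub_eq_add_neg] using this) x hx
  exact sub_eq_zero.1 hdiff
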